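/- There is an infinite sequence $K_0, K_1, K_2, \dots$ of pairwise distinct knots in $S^3$ such that every $K_i$ is a two-bridge knot (its bridge number is $2$), every $K_i$ has unknotting number one, and the degrees of the Alexander polynomials $\Delta_{K_i}(t)$ tend to infinity as $i \to \infty$. Here the Alexander polynomial, which is defined up to units $\pm t^k$ of $\mathbb{Z}[t,t^{-1}]$, is normalized to be a polynomial in $\mathbb{Z}[t]$ with non-zero constant term. -/

import Mathlib

/-!
Oriented knots are modelled by planar diagrams in Morse position, modulo planar isotopy and
Reidemeister moves.  A diagram is read from bottom to top as a finite sequence of elementary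
pieces, each of which contains exactly one local minimum, local maximum or crossing, together
with vertical strands to its left and to its right.  A horizontal level of a diagram is recorded
by the list of the orientations of the strands that it meets, from left to right;
`true` stands for upwards and `false` for downwards.
-/

namespace KnotTheory

open Polynomial LaurentPolynomial

/-- The singular part of an elementary piece of a diagram. -/
inductive Elem : Type
  /-- A local minimum; the orientations of its two ends are `o` (left) and `!o` (right). -/
  | cup (o : Bool)
  /-- A local maximum; the orientations of its two ends are `o` (left) and `!o` (right). -/
  | cap (o : Bool)
  /-- A crossing of a strand from bottom left to top right, of orientation `x`, and a strand from
  bottom right to top left, of orientation `y`.  The strand from bottom left to top right is the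
  upper one (nearer to the viewer) if `s = true`, and it is the lower one if `s = false`. -/
  | cross (x y s : Bool)

/-- The orientations of the lower ends. -/
def Elem.src : Elem → List Bool
  | .cup _ => []
  | .cap o => [o, !o]
  | .cross x y _ => [x, y]

/-- The orientations of the upper ends. -/
def Elem.tgt : Elem → List Bool
  | .cup o => [o, !o]
  | .cap _ => []
  | .cross x y _ => [y, x]

/-- An elementary piece: a minimum, maximum or crossing, with vertical strands of the listed
orientations to its left and to its right. -/
structure Piece : Type where
  left : List Bool
  elem : Elem
  right : List Bool

/-- The bottom level of a piece. -/
def Piece.src (p : Piece) : List Bool := p.left ++ p.elem.src ++ p.right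

/-- The top level of a piece. -/
def Piece.tgt (p : Piece) : List Bool := p.left ++ p.elem.tgt ++ p.right

/-- The pieces of the list `w` can be stacked on top of each other, from level `u` at the bottom
to level `v` at the top. -/
def IsTangle : List Bool → List Piece → List Bool → Prop
  | u, [], v => u = v
  | u, p :: w, v => p.src = u ∧ IsTangle p.tgt w v

/-- The points in which a diagram without boundary meets its horizontal levels: `(k, j)` is the
`j`-th point, counted from the left and from `0`, on the bottom level of the `k`-th piece. -/
def points (w : List Piece) : Set (ℕ × ℕ) :=
  {P | ∃ p, w[P.1]? = some p ∧ P.2 < p.src.length}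

/-- `Arc w P Q`: some piece contains a strand with ends `P` and `Q` that is not the lower
strand of a crossing. -/
inductive Arc (w : List Piece) : ℕ × ℕ → ℕ × ℕ → Prop
  | left (k j : ℕ) (p : Piece) : w[k]? = some p → j < p.left.length →
      Arc w (k, j) (k + 1, j)
  | right (k j : ℕ) (p : Piece) : w[k]? = some p → j < p.right.length →
      Arc w (k, p.left.length + p.elem.src.length + j)
        (k + 1, p.left.length + p.elem.tgt.length + j)
  | cup (k : ℕ) (a b : List Bool) (o : Bool) : w[k]? = some ⟨a, .cup o, b⟩ →
      Arc w (k + 1, a.length) (k + 1, a.length + 1)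
  | cap (k : ℕ) (a b : List Bool) (o : Bool) : w[k]? = some ⟨a, .cap o, b⟩ →
      Arc w (k, a.length) (k, a.length + 1)
  | over_true (k : ℕ) (a b : List Bool) (x y : Bool) : w[k]? = some ⟨a, .cross x y true, b⟩ →
      Arc w (k, a.length) (k + 1, a.length + 1)
  | over_false (k : ℕ) (a b : List Bool) (x y : Bool) : w[k]? = some ⟨a, .cross x y false, b⟩ →
      Arc w (k, a.length + 1) (k + 1, a.length)

/-- `Under w P Q R`: at some crossing, the lower strand has the end `P` on the left and the end
`Q` on the right of the (oriented) upper strand, and `R` is the bottom end of the upper strand. -/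
inductive Under (w : List Piece) : ℕ × ℕ → ℕ × ℕ → ℕ × ℕ → Prop
  | true_up (k : ℕ) (a b : List Bool) (y : Bool) : w[k]? = some ⟨a, .cross true y true, b⟩ →
      Under w (k + 1, a.length) (k, a.length + 1) (k, a.length)
  | true_down (k : ℕ) (a b : List Bool) (y : Bool) : w[k]? = some ⟨a, .cross false y true, b⟩ →
      Under w (k, a.length + 1) (k + 1, a.length) (k, a.length)
  | false_up (k : ℕ) (a b : List Bool) (x : Bool) : w[k]? = some ⟨a, .cross x true false, b⟩ →
      Under w (k, a.length) (k + 1, a.length + 1) (k, a.length + 1)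
  | false_down (k : ℕ) (a b : List Bool) (x : Bool) : w[k]? = some ⟨a, .cross x false false, b⟩ →
      Under w (k + 1, a.length + 1) (k, a.length) (k, a.length + 1)

/-- Some piece contains a strand with ends `P` and `Q`. -/
def Joined (w : List Piece) (P Q : ℕ × ℕ) : Prop := Arc w P Q ∨ ∃ R, Under w P Q R

/-- An oriented knot diagram in Morse position: a diagram without boundary that has exactly one
component. -/
structure KnotDiagram : Type where
  word : List Piece
  isTangle : IsTangle [] word []
  nonempty : (points word).Nonempty
  connected : ∀ P ∈ points word, ∀ Q ∈ points word, Relation.EqvGen (Joined word) P Q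

/-- The local moves on diagrams in Morse position.  The first three generate planar isotopy
(together with `slide_cup`, `slide_cap`, which turn crossings past minima and maxima); the others
are the Reidemeister moves. -/
inductive Move : List Piece → List Piece → Prop
  /-- Two pieces that are beside each other change their heights. -/
  | interchange (a b c : List Bool) (e f : Elem) :
      Move [⟨a, e, b ++ f.src ++ c⟩, ⟨a ++ e.tgt ++ b, f, c⟩]
        [⟨a ++ e.src ++ b, f, c⟩, ⟨a, e, b ++ f.tgt ++ c⟩]
  /-- A minimum cancels a maximum on its left. -/
  | snake_left (a b : List Bool) (x : Bool) :
      Move [⟨a ++ [x], .cup (!x), b⟩, ⟨a, .cap x, [x] ++ b⟩] []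
  /-- A minimum cancels a maximum on its right. -/
  | snake_right (a b : List Bool) (x : Bool) :
      Move [⟨a, .cup x, [x] ++ b⟩, ⟨a ++ [x], .cap (!x), b⟩] []
  /-- A strand moves across a minimum, in front of it or behind it. -/
  | slide_cup (a b : List Bool) (o x s : Bool) :
      Move [⟨a, .cup o, [x] ++ b⟩, ⟨a ++ [o], .cross (!o) x s, b⟩]
        [⟨a ++ [x], .cup o, b⟩, ⟨a, .cross x o (!s), [!o] ++ b⟩]
  /-- A strand moves across a maximum, in front of it or behind it. -/
  | slide_cap (a b : List Bool) (o x s : Bool) :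
      Move [⟨a ++ [o], .cross x (!o) s, b⟩, ⟨a, .cap o, [x] ++ b⟩]
        [⟨a, .cross o x (!s), [!o] ++ b⟩, ⟨a ++ [x], .cap o, b⟩]
  /-- First Reidemeister move, at a minimum. -/
  | reidemeister_one_cup (a b : List Bool) (o s : Bool) :
      Move [⟨a, .cup o, b⟩, ⟨a, .cross o (!o) s, b⟩] [⟨a, .cup (!o), b⟩]
  /-- First Reidemeister move, at a maximum. -/
  | reidemeister_one_cap (a b : List Bool) (o s : Bool) :
      Move [⟨a, .cross o (!o) s, b⟩, ⟨a, .cap (!o), b⟩] [⟨a, .cap o, b⟩]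
  /-- Second Reidemeister move. -/
  | reidemeister_two (a b : List Bool) (x y s : Bool) :
      Move [⟨a, .cross x y s, b⟩, ⟨a, .cross y x (!s), b⟩] []
  /-- Third Reidemeister move, for three strands `x`, `y`, `z`.  The hypothesis says that one of
  the strands is above and one is below the two others. -/
  | reidemeister_three (a b : List Bool) (x y z s₁ s₂ s₃ : Bool) : s₂ = s₁ ∨ s₂ = s₃ →
      Move [⟨a, .cross x y s₁, [z] ++ b⟩, ⟨a ++ [y], .cross x z s₂, b⟩,
          ⟨a, .cross y z s₃, [x] ++ b⟩]
        [⟨a ++ [x], .cross y z s₃, b⟩, ⟨a, .cross x z s₂, [y] ++ b⟩,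
          ⟨a ++ [z], .cross x y s₁, b⟩]

/-- `D'` is obtained from `D` by one local move. -/
def Step (D D' : KnotDiagram) : Prop :=
  ∃ u l r v : List Piece, Move l r ∧ D.word = u ++ l ++ v ∧ D'.word = u ++ r ++ v

/-- Two diagrams are equivalent if finitely many local moves and their inverses transform one
into the other. -/
instance knotSetoid : Setoid KnotDiagram := Relation.EqvGen.setoid Step

/-- Oriented knots (in the 3-sphere, up to isotopy): knot diagrams up to equivalence. -/
def Knot : Type := Quotient knotSetoid

/-- The knot that a diagram represents. -/
def KnotDiagram.knot (D : KnotDiagram) : Knot := Quotient.mk knotSetoid D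

/-- The circle: one minimum and one maximum. -/
def circle : KnotDiagram where
  word := [⟨[], .cup true, []⟩, ⟨[], .cap true, []⟩]
  isTangle := by simp [IsTangle, Piece.src, Piece.tgt, Elem.src, Elem.tgt]
  nonempty := ⟨(1, 0), ⟨[], .cap true, []⟩, by simp, by simp [Piece.src, Elem.src]⟩
  connected := by
    have key : ∀ P ∈ points [⟨[], .cup true, []⟩, ⟨[], .cap true, []⟩],
        Relation.EqvGen (Joined [⟨[], .cup true, []⟩, ⟨[], .cap true, []⟩]) (1, 0) P := by
      rintro ⟨k, j⟩ ⟨p, hp, hj⟩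
      match k with
      | 0 =>
        simp only [List.getElem?_cons_zero, Option.some.injEq] at hp
        subst hp
        simp [Piece.src, Elem.src] at hj
      | 1 =>
        simp only [List.getElem?_cons_succ, List.getElem?_cons_zero, Option.some.injEq] at hp
        subst hp
        simp only [Piece.src, Elem.src, List.nil_append, List.append_nil, List.length_cons,
          List.length_nil] at hj
        have h2 : j = 0 ∨ j = 1 := by omega
        rcases h2 with rfl | rfl
        · exact Relation.EqvGen.refl _
        · exact Relation.EqvGen.rel _ _ (Or.inl (Arc.cap 1 [] [] true (by simp)))
      | k + 2 => simp at hp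
    intro P hP Q hQ
    exact ((key P hP).symm).trans _ _ _ (key Q hQ)

/-- The trivial knot. -/
def unknot : Knot := circle.knot

/-- `CrossingChanges n w w'`: the diagram `w'` is obtained from `w` by changing `n` of its
crossings, that is, by exchanging the upper and the lower strand at each of them. -/
inductive CrossingChanges : ℕ → List Piece → List Piece → Prop
  | nil : CrossingChanges 0 [] []
  | keep (n : ℕ) (w w' : List Piece) (p : Piece) : CrossingChanges n w w' →
      CrossingChanges n (p :: w) (p :: w')
  | change (n : ℕ) (w w' : List Piece) (a b : List Bool) (x y s : Bool) :
      CrossingChanges n w w' →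
      CrossingChanges (n + 1) (⟨a, .cross x y s, b⟩ :: w) (⟨a, .cross x y (!s), b⟩ :: w')

/-- The unknotting number: the least number of crossings which have to be changed, in a suitable
diagram of the knot, in order to get a diagram of the trivial knot. -/
noncomputable def unknottingNumber (K : Knot) : ℕ :=
  sInf {n | ∃ D D' : KnotDiagram,
    D.knot = K ∧ D'.knot = unknot ∧ CrossingChanges n D.word D'.word}

/-- The piece contains a local maximum. -/
def Piece.isCap (p : Piece) : Bool :=
  match p.elem with
  | .cap _ => true
  | _ => false

/-- The bridge number: the least number of local maxima in a diagram of the knot. -/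
noncomputable def bridgeNumber (K : Knot) : ℕ :=
  sInf {n | ∃ D : KnotDiagram, D.knot = K ∧ D.word.countP Piece.isCap = n}

/-- A two-bridge knot is a knot of bridge number two. -/
def IsTwoBridge (K : Knot) : Prop := bridgeNumber K = 2

/-- The rows of an Alexander matrix of a diagram, over the Laurent polynomials in `t = T 1`.  The
columns belong to the points of the diagram.  The rows express that points on the same overpass
are equal, and that `P = t * Q + (1 - t) * R` where the points `P` on the left and `Q` on the
right are separated by an upper strand through `R` (the Fox derivatives of the Wirtinger
relations). -/
inductive AlexanderRow (w : List Piece) : (ℕ × ℕ → ℤ[T;T⁻¹]) → Prop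
  | arc (P Q : ℕ × ℕ) : Arc w P Q → AlexanderRow w (Pi.single P 1 - Pi.single Q 1)
  | under (P Q R : ℕ × ℕ) : Under w P Q R →
      AlexanderRow w (Pi.single P 1 - Pi.single Q (T 1) - Pi.single R (1 - T 1))

/-- The first elementary ideal of the Alexander matrix: if the matrix has `m + 1` columns, this is
the ideal generated by its minors of size `m`. -/
noncomputable def alexanderIdeal (w : List Piece) : Ideal ℤ[T;T⁻¹] :=
  Ideal.span {d | ∃ (m : ℕ) (r : Fin m → ℕ × ℕ → ℤ[T;T⁻¹]) (c : Fin m → ℕ × ℕ),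
    (points w).ncard = m + 1 ∧ (∀ i, AlexanderRow w (r i)) ∧ (∀ j, c j ∈ points w) ∧
    d = (Matrix.of fun i j => r i (c j)).det}

/-- `Δ` is the Alexander polynomial of `K`, normalized to be a polynomial with non-zero constant
term (which determines it up to sign): for every diagram of `K`, it generates the first elementary
ideal of the Alexander matrix. -/
def IsAlexanderPolynomial (K : Knot) (Δ : ℤ[X]) : Prop :=
  Δ.coeff 0 ≠ 0 ∧
    ∀ D : KnotDiagram, D.knot = K → alexanderIdeal D.word = Ideal.span {Polynomial.toLaurent Δ}

end KnotTheory

/-! For n ≥ 1 let K_n be the plat closure of the braid σ₂^(n+1) σ₁² σ₂^(-n), a diagram with two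
maxima. Changing one of the two σ₁ crossings makes them cancel by a Reidemeister II move. The powers
of σ₂ then cancel up to a single σ₂, whose closure is an unknot with a kink. So the bridge number is
at most 2 and the unknotting number at most 1. Everything else follows from one invariant, the
Alexander ideal.

The Alexander polynomial of K_n turns out to be Δ_n = A_(n+1)² - t A_n², where A_n = 1 - t + t² - ⋯
has n terms. Its degree is 2n, and Δ_n(-1) = (n+1)² + n². This value exceeds 1 and increases with n,
so Δ_n is not a unit and the K_n are pairwise distinct. A diagram with at most one maximum has unit
ideal (`alexanderIdeal_eq_top`). Applied to arbitrary diagrams of K_n this bounds the bridge number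
from below; applied to the circle it shows that K_n is knotted.

Most of the work is the invariance of the ideal under the local moves. A diagram is coloured level
by level with elements of a quandle-like structure (`ColorRule`). Each move preserves the colourings
of the boundary of the changed part, and these determine the colours inside. For the rule P = tQ +
(1 - t)R, the cokernel of the Alexander matrix carries a universal colouring (`exists_isUniversal`),
so a move induces an isomorphism of these modules (`IsUniversal.exists_linearEquiv`). The ideal of
corank one minors depends only on the module, not on the generators (`minorIdeal_eq`, Fitting's
lemma). It can therefore be computed from any finite generating family.

The universal colouring of K_n is generated by the colours a and b of the two minima. Pushing them
through the braid is linear algebra in b - a, and the two maxima impose exactly Δ_n (b - a) = 0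
(`exists_col_platTop`).

Colourings whose colours never change detect components. They show that moves and crossing changes
preserve connectedness, so that intermediate words are knot diagrams. -/

namespace KnotTheory

/-! ### Fitting's lemma for the ideal of corank one minors. -/

section MinorIdeal

variable {R : Type*} [CommRing R] {M : Type*} [AddCommGroup M] [Module R M]

/-- The ideal generated by the minors of corank one of the matrix of all relations between the
members of the family `x`. -/
def minorIdeal {ι : Type*} [Fintype ι] (x : ι → M) : Ideal R :=
  Ideal.span {d | ∃ (m : ℕ) (r : Fin m → ι → R) (c : Fin m → ι), Fintype.card ι = m + 1 ∧
    (∀ k, ∑ i, r k i • x i = 0) ∧ d = (Matrix.of fun k j => r k (c j)).det}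

theorem minorIdeal_comp_equiv_le {ι κ : Type*} [Fintype ι] [Fintype κ] (e : ι ≃ κ) (x : κ → M) :
    (minorIdeal (x ∘ e) : Ideal R) ≤ minorIdeal x := by
  refine Ideal.span_le.2 ?_
  rintro _ ⟨m, r, c, hm, hr, rfl⟩
  refine Ideal.subset_span ⟨m, fun k j => r k (e.symm j), fun j => e (c j), ?_, ?_, by simp⟩
  · rw [← hm, Fintype.card_congr e]
  · intro k
    rw [← hr k, ← e.sum_comp]
    simp

theorem minorIdeal_comp_equiv {ι κ : Type*} [Fintype ι] [Fintype κ] (e : ι ≃ κ) (x : κ → M) :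
    (minorIdeal (x ∘ e) : Ideal R) = minorIdeal x := by
  refine le_antisymm (minorIdeal_comp_equiv_le e x) ?_
  have := minorIdeal_comp_equiv_le (R := R) e.symm (x ∘ e)
  rwa [Function.comp_assoc, e.self_comp_symm, Function.comp_id] at this

theorem minorIdeal_map_linearEquiv {N : Type*} [AddCommGroup N] [Module R N] {ι : Type*}
    [Fintype ι] (φ : M ≃ₗ[R] N) (x : ι → M) :
    (minorIdeal (φ ∘ x) : Ideal R) = minorIdeal x := by
  have h : ∀ r : ι → R, ∑ i, r i • (φ ∘ x) i = 0 ↔ ∑ i, r i • x i = 0 := by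
    intro r
    rw [← map_eq_zero_iff φ φ.injective]
    simp
  simp only [minorIdeal, h]

/-- A minor of a matrix plus a matrix of rank one belongs to any ideal that contains the minors of
the first matrix of one size less. -/
theorem det_add_rank_one_mem {κ : Type*} (I : Ideal R) {m : ℕ} (a : Fin (m + 1) → κ → R)
    (s : Fin (m + 1) → R) (w : κ → R) (c : Fin (m + 1) → κ)
    (hI : ∀ (p : Fin m → Fin (m + 1)) (g : Fin m → κ),
      (Matrix.of fun k j => a (p k) (g j)).det ∈ I) :
    (Matrix.of fun k j => a k (c j) + s k * w (c j)).det ∈ I := by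
  -- Border the matrix by a first row (1, w). Subtracting multiples of this row removes the rank one
  -- part at the price of a first column (1, -s), along which the determinant is expanded.
  let t : Fin (m + 2) → R := Fin.cons 1 (fun j => w (c j))
  let B₁ : Matrix (Fin (m + 2)) (Fin (m + 2)) R :=
    Matrix.of (Fin.cons t fun k => Fin.cons 0 fun j => a k (c j) + s k * w (c j))
  let B₂ : Matrix (Fin (m + 2)) (Fin (m + 2)) R :=
    Matrix.of (Fin.cons t fun k => Fin.cons (-s k) fun j => a k (c j))
  have h12 : B₁.det = B₂.det := by
    refine Matrix.det_eq_of_forall_row_eq_smul_add_const (Fin.cons 0 s) 0 rfl ?_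
    intro i j
    refine Fin.cases ?_ (fun i => ?_) i <;> refine Fin.cases ?_ (fun j => ?_) j <;>
      simp [B₁, B₂, t]
  have h1 : B₁.det = (Matrix.of fun k j => a k (c j) + s k * w (c j)).det := by
    rw [Matrix.det_succ_column_zero, Fin.sum_univ_succ]
    simp [B₁, t, Matrix.submatrix]
  rw [← h1, h12, Matrix.det_succ_column_zero]
  refine Ideal.sum_mem _ fun i _ => Ideal.mul_mem_left _ _ ?_
  refine Fin.cases ?_ (fun k => ?_) i
  · rw [Matrix.det_succ_column_zero]
    refine Ideal.sum_mem _ fun l _ => Ideal.mul_mem_left _ _ ?_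
    exact hI (fun k => l.succAbove k) (fun j => c j.succ)
  · rw [Matrix.det_succ_row_zero]
    refine Ideal.sum_mem _ fun l _ => Ideal.mul_mem_left _ _ ?_
    convert hI (fun r => k.succAbove r) (fun j => c (l.succAbove j)) using 2
    ext r j
    simp [B₂, Matrix.submatrix]

/-- The relation (1, -v) expresses the redundant generator. Subtracting multiples of it from the
rows clears the column `none` and leaves relations among the old generators, so the given matrix is
one of old relations plus a matrix of rank one, and `det_add_rank_one_mem` applies. -/
theorem minorIdeal_option_le {ι : Type*} [Fintype ι] [Nonempty ι] (x : ι → M) (v : ι → R) :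
    (minorIdeal (fun o : Option ι => o.elim (∑ i, v i • x i) x) : Ideal R) ≤ minorIdeal x := by
  refine Ideal.span_le.2 ?_
  rintro _ ⟨n, r, c, hn, hr, rfl⟩
  obtain ⟨m, hm⟩ := Nat.exists_eq_add_one.2 (Fintype.card_pos (α := ι))
  obtain rfl : n = m + 1 := by rw [Fintype.card_option] at hn; omega
  let w : Option ι → R := fun o => o.elim 1 (fun i => -v i)
  let a : Fin (m + 1) → Option ι → R := fun k o => r k o - r k none * w o
  have ha : ∀ k, ∑ i, a k (some i) • x i = 0 := by
    intro k
    rw [← hr k, Fintype.sum_option]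
    simp [a, w, add_smul, Finset.sum_add_distrib, Finset.smul_sum, mul_smul, add_comm]
  have key := det_add_rank_one_mem (minorIdeal x) a (fun k => r k none) w c ?_
  · simpa [a] using key
  · intro p g
    by_cases hg : ∃ j, g j = none
    · obtain ⟨j, hj⟩ := hg
      rw [Matrix.det_eq_zero_of_column_eq_zero j]
      · exact Ideal.zero_mem _
      · intro k
        simp [hj, a, w]
    · have : ∀ j, ∃ i, g j = some i := fun j => Option.ne_none_iff_exists'.1 fun h => hg ⟨j, h⟩
      choose d hd using this
      refine Ideal.subset_span ⟨m, fun k i => a (p k) (some i), d, hm, fun k => ha _, ?_⟩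
      simp [hd]

/-- Bordering a minor by the relation (1, -v) and the column `none` gives a block triangular matrix
with the same determinant. -/
theorem le_minorIdeal_option {ι : Type*} [Fintype ι] (x : ι → M) (v : ι → R) :
    (minorIdeal x : Ideal R) ≤ minorIdeal (fun o : Option ι => o.elim (∑ i, v i • x i) x) := by
  refine Ideal.span_le.2 ?_
  rintro _ ⟨m, r, c, hm, hr, rfl⟩
  refine Ideal.subset_span ⟨m + 1, Fin.cons (fun o => o.elim 1 (fun i => -v i))
    (fun k o => o.elim 0 (r k)), Fin.cons none (fun j => some (c j)), ?_, ?_, ?_⟩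
  · rw [Fintype.card_option, hm]
  · intro k
    refine Fin.cases ?_ (fun k => ?_) k
    · simp [Fintype.sum_option]
    · simp [Fintype.sum_option, hr k]
  · rw [Matrix.det_succ_column_zero, Fin.sum_univ_succ]
    simp [Matrix.submatrix]

theorem minorIdeal_option {ι : Type*} [Fintype ι] [Nonempty ι] (x : ι → M) (y : M)
    (hy : y ∈ Submodule.span R (Set.range x)) :
    (minorIdeal (fun o : Option ι => o.elim y x) : Ideal R) = minorIdeal x := by
  obtain ⟨v, rfl⟩ := (Submodule.mem_span_range_iff_exists_fun R).1 hy
  exact le_antisymm (minorIdeal_option_le x v) (le_minorIdeal_option x v)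

theorem minorIdeal_sum {ι κ : Type*} [Fintype ι] [Nonempty ι] [Fintype κ] (x : ι → M)
    (y : κ → M) (hy : ∀ k, y k ∈ Submodule.span R (Set.range x)) :
    (minorIdeal (Sum.elim x y) : Ideal R) = minorIdeal x := by
  revert y
  refine Fintype.induction_empty_option (P := fun κ _ => ∀ y : κ → M,
    (∀ k, y k ∈ Submodule.span R (Set.range x)) →
      (minorIdeal (Sum.elim x y) : Ideal R) = minorIdeal x) ?_ ?_ ?_ κ
  · intro α β _ e ih y hy
    let := Fintype.ofEquiv β e.symm
    rw [← minorIdeal_comp_equiv ((Equiv.refl ι).sumCongr e)]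
    convert ih (y ∘ e) (fun k => hy _)
    ext i
    cases i <;> rfl
  · intro y hy
    rw [← minorIdeal_comp_equiv (Equiv.sumEmpty ι PEmpty).symm]
    rfl
  · intro α _ ih y hy
    let e : Option (ι ⊕ α) ≃ ι ⊕ Option α :=
      { toFun := fun o => o.elim (Sum.inr none) (Sum.map id some)
        invFun := Sum.elim (fun i => some (Sum.inl i))
          (fun o => o.elim none fun k => some (Sum.inr k))
        left_inv := by rintro (_ | _ | _) <;> rfl
        right_inv := by rintro (_ | _ | _) <;> rfl }
    rw [← ih (fun k => y (some k)) (fun k => hy _), ← minorIdeal_comp_equiv e,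
      ← minorIdeal_option (Sum.elim x fun k => y (some k)) (y none)]
    · congr 1
      funext i
      rcases i with _ | _ | _ <;> rfl
    · refine Submodule.span_mono ?_ (hy none)
      rintro _ ⟨i, rfl⟩
      exact ⟨Sum.inl i, rfl⟩

/-- The ideal of minors does not depend on the generating family. -/
theorem minorIdeal_eq {ι κ : Type*} [Fintype ι] [Nonempty ι] [Fintype κ] [Nonempty κ] (x : ι → M)
    (y : κ → M) (hx : Submodule.span R (Set.range x) = ⊤)
    (hy : Submodule.span R (Set.range y) = ⊤) :
    (minorIdeal x : Ideal R) = minorIdeal y := by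
  rw [← minorIdeal_sum x y (by simp [hx]), ← minorIdeal_sum y x (by simp [hy]),
    ← minorIdeal_comp_equiv (Equiv.sumComm ι κ)]
  congr 1
  funext i
  rcases i with _ | _ <;> rfl

/-- It suffices to take the minors of the rows in a set that generates all relations. -/
theorem det_mem_span_of_rows_mem_span {ι : Type*} {m : ℕ} (S : Set (ι → R)) (c : Fin m → ι)
    (I : Ideal R) (hI : ∀ r : Fin m → ι → R, (∀ k, r k ∈ S) →
      (Matrix.of fun k j => r k (c j)).det ∈ I) (r : Fin m → ι → R)
    (hr : ∀ k, r k ∈ Submodule.span R S) : (Matrix.of fun k j => r k (c j)).det ∈ I := by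
  let f : (ι → R) →ₗ[R] (Fin m → R) := LinearMap.funLeft R R c
  -- Rows are replaced one at a time: those in `s` lie only in the span, the others in `S` itself.
  -- Linearity of the determinant in one row reduces the row `a` to elements of `S`.
  suffices h : ∀ s : Finset (Fin m), ∀ r : Fin m → ι → R, (∀ k ∈ s, r k ∈ Submodule.span R S) →
      (∀ k ∉ s, r k ∈ S) → Matrix.detRowAlternating (fun k => f (r k)) ∈ I from
    h Finset.univ r (fun k _ => hr k) (by simp)
  intro s
  induction s using Finset.induction_on with
  | empty => exact fun r _ h => hI r fun k => h k (by simp)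
  | insert a s ha ih =>
    intro r h1 h2
    have h3 : ∀ z ∈ Submodule.span R S,
        Matrix.detRowAlternating (Function.update (fun k => f (r k)) a (f z)) ∈ I := by
      intro z hz
      induction hz using Submodule.span_induction with
      | mem z hz =>
        have : Function.update (fun k => f (r k)) a (f z) =
            fun k => f (Function.update r a z k) := by
          funext k
          by_cases hk : k = a
          · subst hk; simp
          · simp [hk]
        rw [this]
        refine ih _ (fun k hk => ?_) (fun k hk => ?_)
        · have hka : k ≠ a := fun h => ha (h ▸ hk)
          simpa [hka] using h1 k (by simp [hk])
        · by_cases hka : k = a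
          · subst hka; simpa using hz
          · simpa [hka] using h2 k (by simp [hk, hka])
      | zero => simp
      | add z z' _ _ h h' =>
        rw [map_add, AlternatingMap.map_update_add]
        exact I.add_mem h h'
      | smul b z _ h =>
        rw [map_smul, AlternatingMap.map_update_smul]
        exact I.mul_mem_left _ h
    simpa using h3 (r a) (h1 a (by simp))

end MinorIdeal

/-! ### Colourings of tangles, level by level. -/

/-- A rule for colouring diagrams: a strand of colour `a` that passes under a strand of colour `b`
from right to left has the colour `act true a b` afterwards, and `act false a b` if it passes from
left to right. -/
structure ColorRule (X : Type*) where
  act : Bool → X → X → X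
  act_self : ∀ s a, act s a a = a
  act_not : ∀ s a b, act (!s) (act s a b) b = a
  act_act : ∀ s r a b c, act s (act r a b) c = act r (act s a c) (act s b c)

namespace ColorRule

variable {X : Type*} (Q : ColorRule X)

/-- The colour at the top left of a crossing. -/
def topLeft (x s : Bool) (p q : X) : X := bif s then Q.act x q p else q

/-- The colour at the top right of a crossing. -/
def topRight (y s : Bool) (p q : X) : X := bif s then p else Q.act (!y) p q

/-- The colourings of the singular part of a piece. -/
def ElemCol : Elem → List X → List X → Prop
  | .cup _, m, m' => m = [] ∧ ∃ z, m' = [z, z]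
  | .cap _, m, m' => (∃ z, m = [z, z]) ∧ m' = []
  | .cross x y s, m, m' => ∃ p q, m = [p, q] ∧ m' = [Q.topLeft x s p q, Q.topRight y s p q]

/-- The colourings of a piece with the colours `c` at the bottom and `d` at the top. -/
def PieceCol (p : Piece) (c d : List X) : Prop :=
  ∃ A B m m', A.length = p.left.length ∧ B.length = p.right.length ∧ Q.ElemCol p.elem m m' ∧
    c = A ++ (m ++ B) ∧ d = A ++ (m' ++ B)

/-- The colourings of a stack of pieces, with the colours `c` at the bottom, `d` at the top,
and `e` on the successive levels above the bottom. -/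
def Col : List Piece → List X → List (List X) → List X → Prop
  | [], c, e, d => e = [] ∧ c = d
  | p :: w, c, e, d => ∃ c' e', e = c' :: e' ∧ Q.PieceCol p c c' ∧ Col w c' e' d

variable {Q}

theorem ElemCol.length_left {f : Elem} {m m' : List X} (h : Q.ElemCol f m m') :
    m.length = f.src.length := by
  cases f with
  | cup o => obtain ⟨rfl, -⟩ := h; rfl
  | cap o => obtain ⟨⟨z, rfl⟩, -⟩ := h; rfl
  | cross x y s => obtain ⟨p, q, rfl, -⟩ := h; rfl

theorem ElemCol.length_right {f : Elem} {m m' : List X} (h : Q.ElemCol f m m') :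
    m'.length = f.tgt.length := by
  cases f with
  | cup o => obtain ⟨-, z, rfl⟩ := h; rfl
  | cap o => obtain ⟨-, rfl⟩ := h; rfl
  | cross x y s => obtain ⟨p, q, -, rfl⟩ := h; rfl

theorem PieceCol.length_left {p : Piece} {c d : List X} (h : Q.PieceCol p c d) :
    c.length = p.src.length := by
  obtain ⟨A, B, m, m', hA, hB, hE, rfl, rfl⟩ := h
  simp [Piece.src, hA, hB, hE.length_left]

theorem PieceCol.length_right {p : Piece} {c d : List X} (h : Q.PieceCol p c d) :
    d.length = p.tgt.length := by
  obtain ⟨A, B, m, m', hA, hB, hE, rfl, rfl⟩ := h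
  simp [Piece.tgt, hA, hB, hE.length_right]

theorem Col.length_right {w : List Piece} {a b : List Bool} (hw : IsTangle a w b)
    {c d : List X} {e : List (List X)} (h : Q.Col w c e d) (hc : c.length = a.length) :
    d.length = b.length := by
  induction w generalizing a c e with
  | nil =>
    obtain ⟨rfl, rfl⟩ := h
    obtain rfl : a = b := hw
    exact hc
  | cons p w ih =>
    obtain ⟨c', e', rfl, hp, h⟩ := h
    exact ih hw.2 h hp.length_right

theorem Col.length {w : List Piece} {c d : List X} {e : List (List X)} (h : Q.Col w c e d) :
    e.length = w.length := by
  induction w generalizing c e with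
  | nil => obtain ⟨rfl, -⟩ := h; rfl
  | cons p w ih =>
    obtain ⟨c', e', rfl, hp, h⟩ := h
    simp [ih h]

theorem col_append {v w : List Piece} {c d : List X} {e : List (List X)} :
    Q.Col (v ++ w) c e d ↔ ∃ e₁ e₂ c', e = e₁ ++ e₂ ∧ Q.Col v c e₁ c' ∧ Q.Col w c' e₂ d := by
  induction v generalizing c e with
  | nil =>
    constructor
    · intro h
      exact ⟨[], e, c, rfl, ⟨rfl, rfl⟩, h⟩
    · rintro ⟨_, e₂, c', rfl, ⟨rfl, rfl⟩, h⟩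
      exact h
  | cons p v ih =>
    constructor
    · rintro ⟨c', e', rfl, hp, h⟩
      obtain ⟨e₁, e₂, c'', rfl, h1, h2⟩ := ih.1 h
      exact ⟨c' :: e₁, e₂, c'', rfl, ⟨c', e₁, rfl, hp, h1⟩, h2⟩
    · rintro ⟨_, e₂, c'', rfl, ⟨c', e₁, rfl, hp, h1⟩, h2⟩
      exact ⟨c', e₁ ++ e₂, rfl, hp, ih.2 ⟨e₁, e₂, c'', rfl, h1, h2⟩⟩

/-- The top level is the last entry of `e`, or `c` if there are no pieces. -/
theorem Col.top_unique {w : List Piece} {c d d' : List X} {e : List (List X)}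
    (h : Q.Col w c e d) (h' : Q.Col w c e d') : d = d' := by
  induction w generalizing c e with
  | nil => exact h.2.symm.trans h'.2
  | cons p w ih =>
    obtain ⟨c', e', rfl, hp, h⟩ := h
    obtain ⟨c'', e'', he, hp', h'⟩ := h'
    obtain ⟨rfl, rfl⟩ := List.cons.inj he
    exact ih h h'

section Map

variable {Y : Type*} {Q' : ColorRule Y} (φ : X → Y)
  (hφ : ∀ s a b, φ (Q.act s a b) = Q'.act s (φ a) (φ b))
include hφ

theorem ElemCol.map {f : Elem} {m m' : List X} (h : Q.ElemCol f m m') :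
    Q'.ElemCol f (m.map φ) (m'.map φ) := by
  cases f with
  | cup o => obtain ⟨rfl, z, rfl⟩ := h; exact ⟨rfl, φ z, rfl⟩
  | cap o => obtain ⟨⟨z, rfl⟩, rfl⟩ := h; exact ⟨⟨φ z, rfl⟩, rfl⟩
  | cross x y s =>
    obtain ⟨p, q, rfl, rfl⟩ := h
    refine ⟨φ p, φ q, rfl, ?_⟩
    cases s <;> simp [topLeft, topRight, hφ]

theorem PieceCol.map {p : Piece} {c d : List X} (h : Q.PieceCol p c d) :
    Q'.PieceCol p (c.map φ) (d.map φ) := by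
  obtain ⟨A, B, m, m', hA, hB, hE, rfl, rfl⟩ := h
  exact ⟨A.map φ, B.map φ, m.map φ, m'.map φ, by simpa, by simpa, hE.map φ hφ, by simp, by simp⟩

theorem Col.map {w : List Piece} {c d : List X} {e : List (List X)} (h : Q.Col w c e d) :
    Q'.Col w (c.map φ) (e.map (List.map φ)) (d.map φ) := by
  induction w generalizing c e with
  | nil => obtain ⟨rfl, rfl⟩ := h; exact ⟨rfl, rfl⟩
  | cons p w ih =>
    obtain ⟨c', e', rfl, hp, h⟩ := h
    exact ⟨_, _, rfl, hp.map φ hφ, ih h⟩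

end Map

theorem exists_append_of_length {A : List X} {m n : ℕ} (h : A.length = m + n) :
    ∃ B C, A = B ++ C ∧ B.length = m ∧ C.length = n :=
  ⟨A.take m, A.drop m, by simp, by simp [h], by simp [h]⟩

theorem pieceCol_concat {a b : List Bool} {x : Bool} {f : Elem} {c d : List X} :
    Q.PieceCol ⟨a ++ [x], f, b⟩ c d ↔ ∃ A B y m m', A.length = a.length ∧ B.length = b.length ∧
      Q.ElemCol f m m' ∧ c = A ++ (y :: (m ++ B)) ∧ d = A ++ (y :: (m' ++ B)) := by
  constructor
  · rintro ⟨A, B, m, m', hA, hB, hE, rfl, rfl⟩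
    obtain ⟨A, Y, rfl, hA', hY⟩ := exists_append_of_length (hA.trans List.length_append)
    obtain ⟨y, rfl⟩ := List.length_eq_one_iff.1 hY
    exact ⟨A, B, y, m, m', hA', hB, hE, by simp, by simp⟩
  · rintro ⟨A, B, y, m, m', hA, hB, hE, rfl, rfl⟩
    exact ⟨A ++ [y], B, m, m', by simp [hA], hB, hE, by simp, by simp⟩

theorem pieceCol_cons {a b : List Bool} {x : Bool} {f : Elem} {c d : List X} :
    Q.PieceCol ⟨a, f, x :: b⟩ c d ↔ ∃ A B y m m', A.length = a.length ∧ B.length = b.length ∧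
      Q.ElemCol f m m' ∧ c = A ++ (m ++ y :: B) ∧ d = A ++ (m' ++ y :: B) := by
  constructor
  · rintro ⟨A, B, m, m', hA, hB, hE, rfl, rfl⟩
    obtain ⟨y, B, rfl⟩ := List.exists_cons_of_length_eq_add_one hB
    exact ⟨A, B, y, m, m', hA, by simpa using hB, hE, by simp, by simp⟩
  · rintro ⟨A, B, y, m, m', hA, hB, hE, rfl, rfl⟩
    exact ⟨A, y :: B, m, m', hA, by simp [hB], hE, by simp, by simp⟩

theorem col_pair {p p' : Piece} {c d : List X} {e : List (List X)} :
    Q.Col [p, p'] c e d ↔ ∃ c', e = [c', d] ∧ Q.PieceCol p c c' ∧ Q.PieceCol p' c' d := by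
  constructor
  · rintro ⟨c', e', rfl, h, d, e'', rfl, h', rfl, rfl⟩
    exact ⟨c', rfl, h, h'⟩
  · rintro ⟨c', rfl, h, h'⟩
    exact ⟨c', [d], rfl, h, d, [], rfl, h', rfl, rfl⟩

theorem col_triple {p p' p'' : Piece} {c d : List X} {e : List (List X)} :
    Q.Col [p, p', p''] c e d ↔ ∃ c' c'', e = [c', c'', d] ∧ Q.PieceCol p c c' ∧
      Q.PieceCol p' c' c'' ∧ Q.PieceCol p'' c'' d := by
  constructor
  · rintro ⟨c', e', rfl, h, c'', e'', rfl, h', d, _, rfl, h'', rfl, rfl⟩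
    exact ⟨c', c'', rfl, h, h', h''⟩
  · rintro ⟨c', c'', rfl, h, h', h''⟩
    exact ⟨c', [c'', d], rfl, h, c'', [d], rfl, h', d, [], rfl, h'', rfl, rfl⟩

theorem col_single {p : Piece} {c d : List X} {e : List (List X)} :
    Q.Col [p] c e d ↔ e = [d] ∧ Q.PieceCol p c d := by
  constructor
  · rintro ⟨c', e', rfl, h, rfl, rfl⟩
    exact ⟨rfl, h⟩
  · rintro ⟨rfl, h⟩
    exact ⟨d, [], rfl, h, rfl, rfl⟩

end ColorRule

/-! ### Explicit colourings of the two sides of each move. -/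

namespace ColorRule

variable {X : Type*} {Q : ColorRule X} {a b : List Bool} {c d : List X} {e : List (List X)}

/-- This lemma and its analogues for the other moves parametrize the colourings of one side by
blocks of colours. The two sides of a move can then be compared through algebraic identities in the
colours alone. -/
theorem col_interchange_left {b' : List Bool} {f g : Elem} :
    Q.Col [⟨a, f, b ++ g.src ++ b'⟩, ⟨a ++ f.tgt ++ b, g, b'⟩] c e d ↔
      ∃ A B C m m' n n', A.length = a.length ∧ B.length = b.length ∧ C.length = b'.length ∧
        Q.ElemCol f m m' ∧ Q.ElemCol g n n' ∧ c = A ++ (m ++ (B ++ (n ++ C))) ∧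
        d = A ++ (m' ++ (B ++ (n' ++ C))) ∧ e = [A ++ (m' ++ (B ++ (n ++ C))), d] := by
  rw [col_pair]
  constructor
  · rintro ⟨c', rfl, ⟨A, R, m, m', hA, hR, hf, rfl, rfl⟩, L, C, n, n', hL, hC, hg, h, rfl⟩
    obtain ⟨R, C₂, rfl, hR, hC₂⟩ := exists_append_of_length (hR.trans List.length_append)
    obtain ⟨B, n₂, rfl, hB, hn₂⟩ := exists_append_of_length (hR.trans List.length_append)
    obtain ⟨L, B₂, rfl, hL, hB₂⟩ := exists_append_of_length (hL.trans List.length_append)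
    obtain ⟨A₂, m₂, rfl, hA₂, hm₂⟩ := exists_append_of_length (hL.trans List.length_append)
    have hm := hf.length_right
    have hn := hg.length_left
    simp only [List.append_assoc] at h
    obtain ⟨rfl, k₁⟩ := List.append_inj h (hA.trans hA₂.symm)
    obtain ⟨rfl, k₂⟩ := List.append_inj k₁ (hm.trans hm₂.symm)
    obtain ⟨rfl, k₃⟩ := List.append_inj k₂ (hB.trans hB₂.symm)
    obtain ⟨rfl, rfl⟩ := List.append_inj k₃ (hn₂.trans hn.symm)
    exact ⟨A, B, C₂, m, m', n₂, n', hA, hB, hC, hf, hg, by simp, by simp, by simp⟩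
  · rintro ⟨A, B, C, m, m', n, n', hA, hB, hC, hf, hg, rfl, rfl, rfl⟩
    exact ⟨_, rfl, ⟨A, B ++ n ++ C, m, m', hA, by simp [hB, hC, hg.length_left], hf, by simp,
      by simp⟩, A ++ m' ++ B, C, n, n', by simp [hA, hB, hf.length_right], hC, hg, by simp,
      by simp⟩

theorem col_interchange_right {b' : List Bool} {f g : Elem} :
    Q.Col [⟨a ++ f.src ++ b, g, b'⟩, ⟨a, f, b ++ g.tgt ++ b'⟩] c e d ↔
      ∃ A B C m m' n n', A.length = a.length ∧ B.length = b.length ∧ C.length = b'.length ∧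
        Q.ElemCol f m m' ∧ Q.ElemCol g n n' ∧ c = A ++ (m ++ (B ++ (n ++ C))) ∧
        d = A ++ (m' ++ (B ++ (n' ++ C))) ∧ e = [A ++ (m ++ (B ++ (n' ++ C))), d] := by
  rw [col_pair]
  constructor
  · rintro ⟨c', rfl, ⟨L, C, n, n', hL, hC, hg, rfl, rfl⟩, A, R, m, m', hA, hR, hf, h, rfl⟩
    obtain ⟨R, C₂, rfl, hR, hC₂⟩ := exists_append_of_length (hR.trans List.length_append)
    obtain ⟨B, n₂, rfl, hB, hn₂⟩ := exists_append_of_length (hR.trans List.length_append)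
    obtain ⟨L, B₂, rfl, hL, hB₂⟩ := exists_append_of_length (hL.trans List.length_append)
    obtain ⟨A₂, m₂, rfl, hA₂, hm₂⟩ := exists_append_of_length (hL.trans List.length_append)
    have hm := hf.length_left
    have hn := hg.length_right
    simp only [List.append_assoc] at h
    obtain ⟨rfl, k₁⟩ := List.append_inj h (hA₂.trans hA.symm)
    obtain ⟨rfl, k₂⟩ := List.append_inj k₁ (hm₂.trans hm.symm)
    obtain ⟨rfl, k₃⟩ := List.append_inj k₂ (hB₂.trans hB.symm)
    obtain ⟨rfl, rfl⟩ := List.append_inj k₃ (hn.trans hn₂.symm)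
    exact ⟨A₂, B₂, C, m₂, m', n, n', hA, hB, hC, hf, hg, by simp, by simp, by simp⟩
  · rintro ⟨A, B, C, m, m', n, n', hA, hB, hC, hf, hg, rfl, rfl, rfl⟩
    exact ⟨_, rfl, ⟨A ++ m ++ B, C, n, n', by simp [hA, hB, hf.length_left], hC, hg, by simp,
      by simp⟩, A, B ++ n' ++ C, m, m', hA, by simp [hB, hC, hg.length_right], hf, by simp,
      by simp⟩

theorem col_snake_left {x o o' : Bool} :
    Q.Col [⟨a ++ [x], .cup o, b⟩, ⟨a, .cap o', x :: b⟩] c e d ↔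
      ∃ A B z, A.length = a.length ∧ B.length = b.length ∧ c = A ++ z :: B ∧ d = A ++ z :: B ∧
        e = [A ++ z :: z :: z :: B, d] := by
  rw [col_pair]
  simp only [pieceCol_concat, pieceCol_cons]
  constructor
  · rintro ⟨c', rfl, ⟨A, B, y, _, _, hA, hB, ⟨rfl, z, rfl⟩, rfl, rfl⟩,
      A', B', y', _, _, hA', hB', ⟨⟨z', rfl⟩, rfl⟩, h, rfl⟩
    obtain ⟨rfl, k⟩ := List.append_inj h (hA.trans hA'.symm)
    simp only [List.cons_append, List.nil_append, List.cons.injEq] at k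
    obtain ⟨rfl, rfl, rfl, rfl⟩ := k
    exact ⟨A, B, _, hA, hB, rfl, rfl, rfl⟩
  · rintro ⟨A, B, z, hA, hB, rfl, rfl, rfl⟩
    exact ⟨_, rfl, ⟨A, B, z, _, _, hA, hB, ⟨rfl, z, rfl⟩, rfl, rfl⟩,
      A, B, z, _, _, hA, hB, ⟨⟨z, rfl⟩, rfl⟩, rfl, rfl⟩

theorem col_snake_right {x o o' : Bool} :
    Q.Col [⟨a, .cup o, x :: b⟩, ⟨a ++ [x], .cap o', b⟩] c e d ↔
      ∃ A B z, A.length = a.length ∧ B.length = b.length ∧ c = A ++ z :: B ∧ d = A ++ z :: B ∧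
        e = [A ++ z :: z :: z :: B, d] := by
  rw [col_pair]
  simp only [pieceCol_concat, pieceCol_cons]
  constructor
  · rintro ⟨c', rfl, ⟨A, B, y, _, _, hA, hB, ⟨rfl, z, rfl⟩, rfl, rfl⟩,
      A', B', y', _, _, hA', hB', ⟨⟨z', rfl⟩, rfl⟩, h, rfl⟩
    obtain ⟨rfl, k⟩ := List.append_inj h (hA.trans hA'.symm)
    simp only [List.cons_append, List.nil_append, List.cons.injEq] at k
    obtain ⟨rfl, rfl, rfl, rfl⟩ := k
    exact ⟨A, B, _, hA, hB, rfl, rfl, rfl⟩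
  · rintro ⟨A, B, z, hA, hB, rfl, rfl, rfl⟩
    exact ⟨_, rfl, ⟨A, B, z, _, _, hA, hB, ⟨rfl, z, rfl⟩, rfl, rfl⟩,
      A, B, z, _, _, hA, hB, ⟨⟨z, rfl⟩, rfl⟩, rfl, rfl⟩

theorem col_slide_cup_left {x x' y' o o' s : Bool} :
    Q.Col [⟨a, .cup o, x :: b⟩, ⟨a ++ [o'], .cross x' y' s, b⟩] c e d ↔
      ∃ A B y z, A.length = a.length ∧ B.length = b.length ∧ c = A ++ y :: B ∧
        d = A ++ z :: Q.topLeft x' s z y :: Q.topRight y' s z y :: B ∧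
        e = [A ++ z :: z :: y :: B, d] := by
  rw [col_pair]
  simp only [pieceCol_concat, pieceCol_cons]
  constructor
  · rintro ⟨c', rfl, ⟨A, B, y, _, _, hA, hB, ⟨rfl, z, rfl⟩, rfl, rfl⟩,
      A', B', y', _, _, hA', hB', ⟨p, q, rfl, rfl⟩, h, rfl⟩
    obtain ⟨rfl, k⟩ := List.append_inj h (hA.trans hA'.symm)
    simp only [List.cons_append, List.nil_append, List.cons.injEq] at k
    obtain ⟨rfl, rfl, rfl, rfl⟩ := k
    exact ⟨A, B, y, z, hA, hB, rfl, rfl, rfl⟩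
  · rintro ⟨A, B, y, z, hA, hB, rfl, rfl, rfl⟩
    exact ⟨_, rfl, ⟨A, B, y, _, _, hA, hB, ⟨rfl, z, rfl⟩, rfl, rfl⟩,
      A, B, z, _, _, hA, hB, ⟨z, y, rfl, rfl⟩, rfl, rfl⟩

theorem col_slide_cup_right {x x' y' o o' s : Bool} :
    Q.Col [⟨a ++ [x], .cup o, b⟩, ⟨a, .cross x' y' s, o' :: b⟩] c e d ↔
      ∃ A B y z, A.length = a.length ∧ B.length = b.length ∧ c = A ++ y :: B ∧
        d = A ++ Q.topLeft x' s y z :: Q.topRight y' s y z :: z :: B ∧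
        e = [A ++ y :: z :: z :: B, d] := by
  rw [col_pair]
  simp only [pieceCol_concat, pieceCol_cons]
  constructor
  · rintro ⟨c', rfl, ⟨A, B, y, _, _, hA, hB, ⟨rfl, z, rfl⟩, rfl, rfl⟩,
      A', B', y', _, _, hA', hB', ⟨p, q, rfl, rfl⟩, h, rfl⟩
    obtain ⟨rfl, k⟩ := List.append_inj h (hA.trans hA'.symm)
    simp only [List.cons_append, List.nil_append, List.cons.injEq] at k
    obtain ⟨rfl, rfl, rfl, rfl⟩ := k
    exact ⟨A, B, y, z, hA, hB, rfl, rfl, rfl⟩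
  · rintro ⟨A, B, y, z, hA, hB, rfl, rfl, rfl⟩
    exact ⟨_, rfl, ⟨A, B, y, _, _, hA, hB, ⟨rfl, z, rfl⟩, rfl, rfl⟩,
      A, B, z, _, _, hA, hB, ⟨y, z, rfl, rfl⟩, rfl, rfl⟩

theorem col_slide_cap_left {x x' y' o o' s : Bool} :
    Q.Col [⟨a ++ [o], .cross x' y' s, b⟩, ⟨a, .cap o', x :: b⟩] c e d ↔
      ∃ A B p q, A.length = a.length ∧ B.length = b.length ∧
        c = A ++ Q.topLeft x' s p q :: p :: q :: B ∧ d = A ++ Q.topRight y' s p q :: B ∧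
        e = [A ++ Q.topLeft x' s p q :: Q.topLeft x' s p q :: Q.topRight y' s p q :: B, d] := by
  rw [col_pair]
  simp only [pieceCol_concat, pieceCol_cons]
  constructor
  · rintro ⟨c', rfl, ⟨A, B, y, _, _, hA, hB, ⟨p, q, rfl, rfl⟩, rfl, rfl⟩,
      A', B', y', _, _, hA', hB', ⟨⟨z, rfl⟩, rfl⟩, h, rfl⟩
    obtain ⟨rfl, k⟩ := List.append_inj h (hA.trans hA'.symm)
    simp only [List.cons_append, List.nil_append, List.cons.injEq] at k
    obtain ⟨rfl, rfl, rfl, rfl⟩ := k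
    exact ⟨A, B, p, q, hA, hB, rfl, rfl, rfl⟩
  · rintro ⟨A, B, p, q, hA, hB, rfl, rfl, rfl⟩
    exact ⟨_, rfl, ⟨A, B, _, _, _, hA, hB, ⟨p, q, rfl, rfl⟩, rfl, rfl⟩,
      A, B, _, _, _, hA, hB, ⟨⟨_, rfl⟩, rfl⟩, rfl, rfl⟩

theorem col_slide_cap_right {x x' y' o o' s : Bool} :
    Q.Col [⟨a, .cross x' y' s, o :: b⟩, ⟨a ++ [x], .cap o', b⟩] c e d ↔
      ∃ A B p q, A.length = a.length ∧ B.length = b.length ∧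
        c = A ++ p :: q :: Q.topRight y' s p q :: B ∧ d = A ++ Q.topLeft x' s p q :: B ∧
        e = [A ++ Q.topLeft x' s p q :: Q.topRight y' s p q :: Q.topRight y' s p q :: B, d] := by
  rw [col_pair]
  simp only [pieceCol_concat, pieceCol_cons]
  constructor
  · rintro ⟨c', rfl, ⟨A, B, y, _, _, hA, hB, ⟨p, q, rfl, rfl⟩, rfl, rfl⟩,
      A', B', y', _, _, hA', hB', ⟨⟨z, rfl⟩, rfl⟩, h, rfl⟩
    obtain ⟨rfl, k⟩ := List.append_inj h (hA.trans hA'.symm)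
    simp only [List.cons_append, List.nil_append, List.cons.injEq] at k
    obtain ⟨rfl, rfl, rfl, rfl⟩ := k
    exact ⟨A, B, p, q, hA, hB, rfl, rfl, rfl⟩
  · rintro ⟨A, B, p, q, hA, hB, rfl, rfl, rfl⟩
    exact ⟨_, rfl, ⟨A, B, _, _, _, hA, hB, ⟨p, q, rfl, rfl⟩, rfl, rfl⟩,
      A, B, _, _, _, hA, hB, ⟨⟨_, rfl⟩, rfl⟩, rfl, rfl⟩

theorem col_cup {o : Bool} : Q.Col [⟨a, .cup o, b⟩] c e d ↔
    ∃ A B z, A.length = a.length ∧ B.length = b.length ∧ c = A ++ B ∧ d = A ++ z :: z :: B ∧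
      e = [d] := by
  rw [col_single]
  constructor
  · rintro ⟨rfl, A, B, _, _, hA, hB, ⟨rfl, z, rfl⟩, rfl, rfl⟩
    exact ⟨A, B, z, hA, hB, rfl, rfl, rfl⟩
  · rintro ⟨A, B, z, hA, hB, rfl, rfl, rfl⟩
    exact ⟨rfl, A, B, _, _, hA, hB, ⟨rfl, z, rfl⟩, rfl, rfl⟩

theorem col_cap {o : Bool} : Q.Col [⟨a, .cap o, b⟩] c e d ↔
    ∃ A B z, A.length = a.length ∧ B.length = b.length ∧ c = A ++ z :: z :: B ∧ d = A ++ B ∧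
      e = [d] := by
  rw [col_single]
  constructor
  · rintro ⟨rfl, A, B, _, _, hA, hB, ⟨⟨z, rfl⟩, rfl⟩, rfl, rfl⟩
    exact ⟨A, B, z, hA, hB, rfl, rfl, rfl⟩
  · rintro ⟨A, B, z, hA, hB, rfl, rfl, rfl⟩
    exact ⟨rfl, A, B, _, _, hA, hB, ⟨⟨z, rfl⟩, rfl⟩, rfl, rfl⟩

theorem topLeft_self (x s : Bool) (z : X) : Q.topLeft x s z z = z := by
  cases s <;> simp [topLeft, Q.act_self]

theorem topRight_self (x s : Bool) (z : X) : Q.topRight x s z z = z := by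
  cases s <;> simp [topRight, Q.act_self]

theorem col_reidemeister_one_cup {o x y s : Bool} :
    Q.Col [⟨a, .cup o, b⟩, ⟨a, .cross x y s, b⟩] c e d ↔
      ∃ A B z, A.length = a.length ∧ B.length = b.length ∧ c = A ++ B ∧ d = A ++ z :: z :: B ∧
        e = [A ++ z :: z :: B, d] := by
  rw [col_pair]
  constructor
  · rintro ⟨c', rfl, ⟨A, B, _, _, hA, hB, ⟨rfl, z, rfl⟩, rfl, rfl⟩,
      A', B', _, _, hA', hB', ⟨p, q, rfl, rfl⟩, h, rfl⟩
    obtain ⟨rfl, k⟩ := List.append_inj h (hA.trans hA'.symm)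
    simp only [List.cons_append, List.nil_append, List.cons.injEq] at k
    obtain ⟨rfl, rfl, rfl⟩ := k
    exact ⟨A, B, z, hA, hB, rfl, by simp [topLeft_self, topRight_self], rfl⟩
  · rintro ⟨A, B, z, hA, hB, rfl, rfl, rfl⟩
    exact ⟨_, rfl, ⟨A, B, _, _, hA, hB, ⟨rfl, z, rfl⟩, rfl, rfl⟩,
      A, B, _, _, hA, hB, ⟨z, z, rfl, rfl⟩, rfl, by simp [topLeft_self, topRight_self]⟩

theorem topLeft_topLeft (x y s : Bool) (p q : X) :
    Q.topLeft y (!s) (Q.topLeft x s p q) (Q.topRight y s p q) = p := by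
  cases s <;> simp [topLeft, topRight]
  simpa using Q.act_not (!y) p q

theorem topRight_topRight (x y s : Bool) (p q : X) :
    Q.topRight x (!s) (Q.topLeft x s p q) (Q.topRight y s p q) = q := by
  cases s <;> simp [topLeft, topRight, Q.act_not]

/-- The crossing with the opposite sign undoes the passage. -/
theorem cross_injective {x y s : Bool} {p q p' q' : X}
    (h : Q.topLeft x s p q = Q.topLeft x s p' q') (h' : Q.topRight y s p q = Q.topRight y s p' q') :
    p = p' ∧ q = q' := by
  have h1 := topLeft_topLeft (Q := Q) x y s p q
  have h2 := topRight_topRight (Q := Q) x y s p q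
  rw [h, h'] at h1 h2
  rw [topLeft_topLeft] at h1
  rw [topRight_topRight] at h2
  exact ⟨h1.symm, h2.symm⟩

/-- A crossing fixes (z, z) and is injective on pairs, so two equal colours above it force the same
two equal colours below it. -/
theorem col_reidemeister_one_cap {o x y s : Bool} :
    Q.Col [⟨a, .cross x y s, b⟩, ⟨a, .cap o, b⟩] c e d ↔
      ∃ A B z, A.length = a.length ∧ B.length = b.length ∧ c = A ++ z :: z :: B ∧ d = A ++ B ∧
        e = [A ++ z :: z :: B, d] := by
  rw [col_pair]
  constructor
  · rintro ⟨c', rfl, ⟨A, B, _, _, hA, hB, ⟨p, q, rfl, rfl⟩, rfl, rfl⟩,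
      A', B', _, _, hA', hB', ⟨⟨z, rfl⟩, rfl⟩, h, rfl⟩
    obtain ⟨rfl, k⟩ := List.append_inj h (hA.trans hA'.symm)
    simp only [List.cons_append, List.nil_append, List.cons.injEq] at k
    obtain ⟨hp, hq, rfl⟩ := k
    rw [hp, hq]
    obtain ⟨rfl, rfl⟩ := cross_injective (hp.trans (topLeft_self x s z).symm)
      (hq.trans (topRight_self y s z).symm)
    exact ⟨A, B, _, hA, hB, rfl, rfl, rfl⟩
  · rintro ⟨A, B, z, hA, hB, rfl, rfl, rfl⟩
    exact ⟨_, rfl, ⟨A, B, _, _, hA, hB, ⟨z, z, rfl, rfl⟩, rfl,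
      by simp [topLeft_self, topRight_self]⟩, A, B, _, _, hA, hB, ⟨⟨z, rfl⟩, rfl⟩, rfl, rfl⟩

theorem col_reidemeister_two {x y s : Bool} :
    Q.Col [⟨a, .cross x y s, b⟩, ⟨a, .cross y x (!s), b⟩] c e d ↔
      ∃ A B p q, A.length = a.length ∧ B.length = b.length ∧ c = A ++ p :: q :: B ∧
        d = A ++ p :: q :: B ∧ e = [A ++ Q.topLeft x s p q :: Q.topRight y s p q :: B, d] := by
  rw [col_pair]
  constructor
  · rintro ⟨c', rfl, ⟨A, B, _, _, hA, hB, ⟨p, q, rfl, rfl⟩, rfl, rfl⟩,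
      A', B', _, _, hA', hB', ⟨p', q', rfl, rfl⟩, h, rfl⟩
    obtain ⟨rfl, k⟩ := List.append_inj h (hA.trans hA'.symm)
    simp only [List.cons_append, List.nil_append, List.cons.injEq] at k
    obtain ⟨rfl, rfl, rfl⟩ := k
    exact ⟨A, B, p, q, hA, hB, rfl, by simp [topLeft_topLeft, topRight_topRight], rfl⟩
  · rintro ⟨A, B, p, q, hA, hB, rfl, rfl, rfl⟩
    exact ⟨_, rfl, ⟨A, B, _, _, hA, hB, ⟨p, q, rfl, rfl⟩, rfl, rfl⟩, A, B, _, _, hA, hB,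
      ⟨_, _, rfl, rfl⟩, rfl, by simp [topLeft_topLeft, topRight_topRight]⟩

theorem col_reidemeister_three_left {x₁ y₁ x₂ y₂ x₃ y₃ x y z s₁ s₂ s₃ : Bool} :
    Q.Col [⟨a, .cross x₁ y₁ s₁, z :: b⟩, ⟨a ++ [y], .cross x₂ y₂ s₂, b⟩,
      ⟨a, .cross x₃ y₃ s₃, x :: b⟩] c e d ↔
      ∃ A B p q r p₁ q₁ p₂ r₁ q₂ r₂, A.length = a.length ∧ B.length = b.length ∧
        c = A ++ p :: q :: r :: B ∧ q₁ = Q.topLeft x₁ s₁ p q ∧ p₁ = Q.topRight y₁ s₁ p q ∧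
        r₁ = Q.topLeft x₂ s₂ p₁ r ∧ p₂ = Q.topRight y₂ s₂ p₁ r ∧
        r₂ = Q.topLeft x₃ s₃ q₁ r₁ ∧ q₂ = Q.topRight y₃ s₃ q₁ r₁ ∧
        d = A ++ r₂ :: q₂ :: p₂ :: B ∧
        e = [A ++ q₁ :: p₁ :: r :: B, A ++ q₁ :: r₁ :: p₂ :: B, d] := by
  rw [col_triple]
  simp only [pieceCol_concat, pieceCol_cons]
  constructor
  · rintro ⟨c', c'', rfl, ⟨A, B, _, _, _, hA, hB, ⟨p, q, rfl, rfl⟩, rfl, rfl⟩,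
      ⟨A', B', _, _, _, hA', hB', ⟨p', r, rfl, rfl⟩, h, rfl⟩,
      A'', B'', _, _, _, hA'', hB'', ⟨q', r', rfl, rfl⟩, h', rfl⟩
    obtain ⟨rfl, k⟩ := List.append_inj h (hA.trans hA'.symm)
    obtain ⟨rfl, k'⟩ := List.append_inj h' (hA.trans hA''.symm)
    simp only [List.cons_append, List.nil_append, List.cons.injEq] at k k'
    obtain ⟨rfl, rfl, rfl, rfl⟩ := k
    obtain ⟨rfl, rfl, rfl, rfl⟩ := k'
    exact ⟨A, B, p, q, _, _, _, _, _, _, _, hA, hB, rfl, rfl, rfl, rfl, rfl, rfl, rfl, rfl, rfl⟩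
  · rintro ⟨A, B, p, q, r, p₁, q₁, p₂, r₁, q₂, r₂, hA, hB, rfl, rfl, rfl, rfl, rfl, rfl, rfl, rfl,
      rfl⟩
    exact ⟨_, _, rfl, ⟨A, B, _, _, _, hA, hB, ⟨p, q, rfl, rfl⟩, rfl, rfl⟩,
      ⟨A, B, _, _, _, hA, hB, ⟨_, _, rfl, rfl⟩, rfl, rfl⟩,
      A, B, _, _, _, hA, hB, ⟨_, _, rfl, rfl⟩, rfl, rfl⟩

theorem col_reidemeister_three_right {x₁ y₁ x₂ y₂ x₃ y₃ x y z s₁ s₂ s₃ : Bool} :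
    Q.Col [⟨a ++ [x], .cross x₃ y₃ s₃, b⟩, ⟨a, .cross x₂ y₂ s₂, y :: b⟩,
      ⟨a ++ [z], .cross x₁ y₁ s₁, b⟩] c e d ↔
      ∃ A B p q r p₁ q₁ p₂ r₁ q₂ r₂, A.length = a.length ∧ B.length = b.length ∧
        c = A ++ p :: q :: r :: B ∧ r₁ = Q.topLeft x₃ s₃ q r ∧ q₁ = Q.topRight y₃ s₃ q r ∧
        r₂ = Q.topLeft x₂ s₂ p r₁ ∧ p₁ = Q.topRight y₂ s₂ p r₁ ∧
        q₂ = Q.topLeft x₁ s₁ p₁ q₁ ∧ p₂ = Q.topRight y₁ s₁ p₁ q₁ ∧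
        d = A ++ r₂ :: q₂ :: p₂ :: B ∧
        e = [A ++ p :: r₁ :: q₁ :: B, A ++ r₂ :: p₁ :: q₁ :: B, d] := by
  rw [col_triple]
  simp only [pieceCol_concat, pieceCol_cons]
  constructor
  · rintro ⟨c', c'', rfl, ⟨A, B, _, _, _, hA, hB, ⟨p, q, rfl, rfl⟩, rfl, rfl⟩,
      ⟨A', B', _, _, _, hA', hB', ⟨p', r, rfl, rfl⟩, h, rfl⟩,
      A'', B'', _, _, _, hA'', hB'', ⟨q', r', rfl, rfl⟩, h', rfl⟩
    obtain ⟨rfl, k⟩ := List.append_inj h (hA.trans hA'.symm)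
    obtain ⟨rfl, k'⟩ := List.append_inj h' (hA.trans hA''.symm)
    simp only [List.cons_append, List.nil_append, List.cons.injEq] at k k'
    obtain ⟨rfl, rfl, rfl, rfl⟩ := k
    obtain ⟨rfl, rfl, rfl, rfl⟩ := k'
    exact ⟨A, B, _, p, q, _, _, _, _, _, _, hA, hB, rfl, rfl, rfl, rfl, rfl, rfl, rfl, rfl, rfl⟩
  · rintro ⟨A, B, p, q, r, p₁, q₁, p₂, r₁, q₂, r₂, hA, hB, rfl, rfl, rfl, rfl, rfl, rfl, rfl, rfl,
      rfl⟩
    exact ⟨_, _, rfl, ⟨A, B, _, _, _, hA, hB, ⟨q, r, rfl, rfl⟩, rfl, rfl⟩,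
      ⟨A, B, _, _, _, hA, hB, ⟨_, _, rfl, rfl⟩, rfl, rfl⟩,
      A, B, _, _, _, hA, hB, ⟨_, _, rfl, rfl⟩, rfl, rfl⟩

end ColorRule

/-! ### Invariance of colourings under the local moves. -/

namespace ColorRule

variable {X : Type*} {Q : ColorRule X} {l r : List Piece} {c d : List X} {e e' : List (List X)}

/-- In a slide, the colour of the arc on the far side of the moving strand is determined by the old
colours. This and the next three identities give that colour for a cup or a cap, in both directions;
each rests on `act_not`. -/
theorem topRight_slide_cup (o x s : Bool) (y z : X) :
    Q.topLeft x (!s) y (Q.topRight x s z y) = z ∧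
      Q.topRight o (!s) y (Q.topRight x s z y) = Q.topLeft (!o) s z y := by
  cases s
  · simpa [topLeft, topRight] using Q.act_not (!x) z y
  · simp [topLeft, topRight]

theorem topLeft_slide_cup (o x s : Bool) (y z : X) :
    Q.topRight x s (Q.topLeft x (!s) y z) y = z ∧
      Q.topLeft (!o) s (Q.topLeft x (!s) y z) y = Q.topRight o (!s) y z := by
  cases s
  · simp [topLeft, topRight, Q.act_not]
  · simp [topLeft, topRight]

theorem topLeft_slide_cap (o x s : Bool) (p q : X) :
    Q.topRight x (!s) (Q.topLeft x s p q) p = q ∧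
      Q.topLeft o (!s) (Q.topLeft x s p q) p = Q.topRight (!o) s p q := by
  cases s
  · simp [topLeft, topRight]
  · simp [topLeft, topRight, Q.act_not]

theorem topRight_slide_cap (o x s : Bool) (p q : X) :
    Q.topLeft x s q (Q.topRight x (!s) p q) = p ∧
      Q.topRight (!o) s q (Q.topRight x (!s) p q) = Q.topLeft o (!s) p q := by
  cases s
  · simp [topLeft, topRight]
  · simpa [topLeft, topRight] using Q.act_not (!x) p q

/-- This is self-distributivity in six sign patterns. The hypothesis excludes the two patterns s₁ =
s₃ ≠ s₂, in which the three strands lie cyclically above each other. -/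
theorem reidemeister_three_aux (x y z s₁ s₂ s₃ : Bool) (hs : s₂ = s₁ ∨ s₂ = s₃) (p q r : X) :
    Q.topLeft y s₃ (Q.topLeft x s₁ p q) (Q.topLeft x s₂ (Q.topRight y s₁ p q) r) =
        Q.topLeft x s₂ p (Q.topLeft y s₃ q r) ∧
      Q.topRight z s₃ (Q.topLeft x s₁ p q) (Q.topLeft x s₂ (Q.topRight y s₁ p q) r) =
        Q.topLeft x s₁ (Q.topRight z s₂ p (Q.topLeft y s₃ q r)) (Q.topRight z s₃ q r) ∧
      Q.topRight z s₂ (Q.topRight y s₁ p q) r =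
        Q.topRight y s₁ (Q.topRight z s₂ p (Q.topLeft y s₃ q r)) (Q.topRight z s₃ q r) := by
  have hq : Q.act y (Q.act (!y) p q) q = p := by simpa using Q.act_not (!y) p q
  cases s₁ <;> cases s₂ <;> cases s₃ <;> simp [topLeft, topRight] at hs ⊢
  · exact Q.act_act _ _ _ _ _
  · rw [Q.act_act (!y) (!z), Q.act_not]
  · rw [Q.act_act y x, hq]
  · exact Q.act_act _ _ _ _ _
  · exact (Q.act_act _ _ _ _ _).symm
  · exact (Q.act_act _ _ _ _ _).symm

theorem exists_col_of_left (h : Move l r) (hc : Q.Col l c e d) : ∃ e, Q.Col r c e d := by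
  cases h with
  | interchange a b b' f g =>
    obtain ⟨A, B, C, m, m', n, n', hA, hB, hC, hf, hg, rfl, rfl, rfl⟩ := col_interchange_left.1 hc
    exact ⟨_, col_interchange_right.2
      ⟨A, B, C, m, m', n, n', hA, hB, hC, hf, hg, rfl, rfl, rfl⟩⟩
  | snake_left a b x =>
    obtain ⟨A, B, z, hA, hB, rfl, rfl, rfl⟩ := col_snake_left.1 hc
    exact ⟨[], rfl, rfl⟩
  | snake_right a b x =>
    obtain ⟨A, B, z, hA, hB, rfl, rfl, rfl⟩ := col_snake_right.1 hc
    exact ⟨[], rfl, rfl⟩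
  | slide_cup a b o x s =>
    obtain ⟨A, B, y, z, hA, hB, rfl, rfl, rfl⟩ := col_slide_cup_left.1 hc
    refine ⟨_, col_slide_cup_right.2 ⟨A, B, y, Q.topRight x s z y, hA, hB, rfl, ?_, rfl⟩⟩
    rw [(topRight_slide_cup o x s y z).1, (topRight_slide_cup o x s y z).2]
  | slide_cap a b o x s =>
    obtain ⟨A, B, p, q, hA, hB, rfl, rfl, rfl⟩ := col_slide_cap_left.1 hc
    refine ⟨_, col_slide_cap_right.2 ⟨A, B, Q.topLeft x s p q, p, hA, hB, ?_, ?_, rfl⟩⟩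
    · rw [(topLeft_slide_cap o x s p q).1]
    · rw [(topLeft_slide_cap o x s p q).2]
  | reidemeister_one_cup a b o s =>
    obtain ⟨A, B, z, hA, hB, rfl, rfl, rfl⟩ := col_reidemeister_one_cup.1 hc
    exact ⟨_, col_cup.2 ⟨A, B, z, hA, hB, rfl, rfl, rfl⟩⟩
  | reidemeister_one_cap a b o s =>
    obtain ⟨A, B, z, hA, hB, rfl, rfl, rfl⟩ := col_reidemeister_one_cap.1 hc
    exact ⟨_, col_cap.2 ⟨A, B, z, hA, hB, rfl, rfl, rfl⟩⟩
  | reidemeister_two a b x y s =>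
    obtain ⟨A, B, p, q, hA, hB, rfl, rfl, rfl⟩ := col_reidemeister_two.1 hc
    exact ⟨[], rfl, rfl⟩
  | reidemeister_three a b x y z s₁ s₂ s₃ hs =>
    obtain ⟨A, B, p, q, r, _, _, _, _, _, _, hA, hB, rfl, rfl, rfl, rfl, rfl, rfl, rfl, rfl,
      rfl⟩ := col_reidemeister_three_left.1 hc
    refine ⟨_, col_reidemeister_three_right.2
      ⟨A, B, p, q, r, _, _, _, _, _, _, hA, hB, rfl, rfl, rfl, rfl, rfl, rfl, rfl, ?_, rfl⟩⟩
    obtain ⟨h1, h2, h3⟩ := reidemeister_three_aux (Q := Q) x y z s₁ s₂ s₃ hs p q r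
    rw [h1, h2, h3]

theorem exists_col_of_right (h : Move l r) {a b : List Bool} (hl : IsTangle a l b)
    (ha : c.length = a.length) (hc : Q.Col r c e d) : ∃ e, Q.Col l c e d := by
  cases h with
  | interchange a b b' f g =>
    obtain ⟨A, B, C, m, m', n, n', hA, hB, hC, hf, hg, rfl, rfl, rfl⟩ := col_interchange_right.1 hc
    exact ⟨_, col_interchange_left.2
      ⟨A, B, C, m, m', n, n', hA, hB, hC, hf, hg, rfl, rfl, rfl⟩⟩
  | snake_left a b x =>
    obtain ⟨rfl, rfl⟩ := hc
    have h : c.length = a.length + (b.length + 1) := by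
      rw [ha, ← hl.1]
      simp [Piece.src, Elem.src]
    obtain ⟨A, B, rfl, hA, hB⟩ := exists_append_of_length h
    obtain ⟨z, B, rfl⟩ := List.exists_cons_of_length_eq_add_one hB
    exact ⟨_, col_snake_left.2 ⟨A, B, z, hA, by simpa using hB, rfl, rfl, rfl⟩⟩
  | snake_right a b x =>
    obtain ⟨rfl, rfl⟩ := hc
    have h : c.length = a.length + (b.length + 1) := by
      rw [ha, ← hl.1]
      simp [Piece.src, Elem.src]
    obtain ⟨A, B, rfl, hA, hB⟩ := exists_append_of_length h
    obtain ⟨z, B, rfl⟩ := List.exists_cons_of_length_eq_add_one hB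
    exact ⟨_, col_snake_right.2 ⟨A, B, z, hA, by simpa using hB, rfl, rfl, rfl⟩⟩
  | slide_cup a b o x s =>
    obtain ⟨A, B, y, z, hA, hB, rfl, rfl, rfl⟩ := col_slide_cup_right.1 hc
    refine ⟨_, col_slide_cup_left.2 ⟨A, B, y, Q.topLeft x (!s) y z, hA, hB, rfl, ?_, rfl⟩⟩
    rw [(topLeft_slide_cup o x s y z).1, (topLeft_slide_cup o x s y z).2]
  | slide_cap a b o x s =>
    obtain ⟨A, B, p, q, hA, hB, rfl, rfl, rfl⟩ := col_slide_cap_right.1 hc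
    refine ⟨_, col_slide_cap_left.2 ⟨A, B, q, Q.topRight x (!s) p q, hA, hB, ?_, ?_, rfl⟩⟩
    · rw [(topRight_slide_cap o x s p q).1]
    · rw [(topRight_slide_cap o x s p q).2]
  | reidemeister_one_cup a b o s =>
    obtain ⟨A, B, z, hA, hB, rfl, rfl, rfl⟩ := col_cup.1 hc
    exact ⟨_, col_reidemeister_one_cup.2 ⟨A, B, z, hA, hB, rfl, rfl, rfl⟩⟩
  | reidemeister_one_cap a b o s =>
    obtain ⟨A, B, z, hA, hB, rfl, rfl, rfl⟩ := col_cap.1 hc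
    exact ⟨_, col_reidemeister_one_cap.2 ⟨A, B, z, hA, hB, rfl, rfl, rfl⟩⟩
  | reidemeister_two a b x y s =>
    obtain ⟨rfl, rfl⟩ := hc
    have h : c.length = a.length + (b.length + 1 + 1) := by
      rw [ha, ← hl.1]
      simp [Piece.src, Elem.src]
    obtain ⟨A, B, rfl, hA, hB⟩ := exists_append_of_length h
    obtain ⟨p, B, rfl⟩ := List.exists_cons_of_length_eq_add_one hB
    obtain ⟨q, B, rfl⟩ := List.exists_cons_of_length_eq_add_one
      (List.length_cons.symm.trans hB |> Nat.succ.inj)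
    exact ⟨_, col_reidemeister_two.2 ⟨A, B, p, q, hA, by simpa using hB, rfl, rfl, rfl⟩⟩
  | reidemeister_three a b x y z s₁ s₂ s₃ hs =>
    obtain ⟨A, B, p, q, r, _, _, _, _, _, _, hA, hB, rfl, rfl, rfl, rfl, rfl, rfl, rfl, rfl,
      rfl⟩ := col_reidemeister_three_right.1 hc
    refine ⟨_, col_reidemeister_three_left.2
      ⟨A, B, p, q, r, _, _, _, _, _, _, hA, hB, rfl, rfl, rfl, rfl, rfl, rfl, rfl, ?_, rfl⟩⟩
    obtain ⟨h1, h2, h3⟩ := reidemeister_three_aux (Q := Q) x y z s₁ s₂ s₃ hs p q r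
    rw [h1, h2, h3]

/-- The boundary colours determine the colours inside the changed part. Without this, a move would
relate colourings of the two diagrams but not give an isomorphism of the universal modules. -/
theorem col_unique_left (h : Move l r) (hc : Q.Col l c e d) (hc' : Q.Col l c e' d) : e = e' := by
  cases h with
  | interchange a b b' f g =>
    obtain ⟨A, B, C, m, m', n, n', hA, hB, hC, hf, hg, rfl, rfl, rfl⟩ := col_interchange_left.1 hc
    obtain ⟨A₁, B₁, C₁, m₁, m₁', n₁, n₁', hA₁, hB₁, hC₁, hf₁, hg₁, h, h', rfl⟩ :=
      col_interchange_left.1 hc'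
    obtain ⟨rfl, k₁⟩ := List.append_inj h (hA.trans hA₁.symm)
    obtain ⟨rfl, k₂⟩ := List.append_inj k₁ (hf.length_left.trans hf₁.length_left.symm)
    obtain ⟨rfl, k₃⟩ := List.append_inj k₂ (hB.trans hB₁.symm)
    obtain ⟨rfl, rfl⟩ := List.append_inj k₃ (hg.length_left.trans hg₁.length_left.symm)
    obtain ⟨-, k₁⟩ := List.append_inj h' rfl
    obtain ⟨rfl, -⟩ := List.append_inj k₁ (hf.length_right.trans hf₁.length_right.symm)
    rfl
  | snake_left a b x =>
    obtain ⟨A, B, z, hA, hB, rfl, rfl, rfl⟩ := col_snake_left.1 hc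
    obtain ⟨A', B', z', hA', hB', h, h', rfl⟩ := col_snake_left.1 hc'
    obtain ⟨rfl, k⟩ := List.append_inj h (hA.trans hA'.symm)
    simp only [List.cons.injEq] at k
    obtain ⟨rfl, rfl⟩ := k
    rfl
  | snake_right a b x =>
    obtain ⟨A, B, z, hA, hB, rfl, rfl, rfl⟩ := col_snake_right.1 hc
    obtain ⟨A', B', z', hA', hB', h, h', rfl⟩ := col_snake_right.1 hc'
    obtain ⟨rfl, k⟩ := List.append_inj h (hA.trans hA'.symm)
    simp only [List.cons.injEq] at k
    obtain ⟨rfl, rfl⟩ := k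
    rfl
  | slide_cup a b o x s =>
    obtain ⟨A, B, y, z, hA, hB, rfl, rfl, rfl⟩ := col_slide_cup_left.1 hc
    obtain ⟨A', B', y', z', hA', hB', h, h', rfl⟩ := col_slide_cup_left.1 hc'
    obtain ⟨rfl, k⟩ := List.append_inj h (hA.trans hA'.symm)
    obtain ⟨-, k'⟩ := List.append_inj h' rfl
    simp only [List.cons.injEq] at k k'
    obtain ⟨rfl, rfl⟩ := k
    obtain ⟨rfl, -⟩ := k'
    rfl
  | slide_cap a b o x s =>
    obtain ⟨A, B, p, q, hA, hB, rfl, rfl, rfl⟩ := col_slide_cap_left.1 hc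
    obtain ⟨A', B', p', q', hA', hB', h, h', rfl⟩ := col_slide_cap_left.1 hc'
    obtain ⟨rfl, k⟩ := List.append_inj h (hA.trans hA'.symm)
    simp only [List.cons.injEq] at k
    obtain ⟨-, rfl, rfl, rfl⟩ := k
    rfl
  | reidemeister_one_cup a b o s =>
    obtain ⟨A, B, z, hA, hB, rfl, rfl, rfl⟩ := col_reidemeister_one_cup.1 hc
    obtain ⟨A', B', z', hA', hB', h, h', rfl⟩ := col_reidemeister_one_cup.1 hc'
    rw [h']
  | reidemeister_one_cap a b o s =>
    obtain ⟨A, B, z, hA, hB, rfl, rfl, rfl⟩ := col_reidemeister_one_cap.1 hc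
    obtain ⟨A', B', z', hA', hB', h, h', rfl⟩ := col_reidemeister_one_cap.1 hc'
    rw [h]
  | reidemeister_two a b x y s =>
    obtain ⟨A, B, p, q, hA, hB, rfl, rfl, rfl⟩ := col_reidemeister_two.1 hc
    obtain ⟨A', B', p', q', hA', hB', h, h', rfl⟩ := col_reidemeister_two.1 hc'
    obtain ⟨rfl, k⟩ := List.append_inj h (hA.trans hA'.symm)
    simp only [List.cons.injEq] at k
    obtain ⟨rfl, rfl, rfl⟩ := k
    rfl
  | reidemeister_three a b x y z s₁ s₂ s₃ hs =>
    obtain ⟨A, B, p, q, r, _, _, _, _, _, _, hA, hB, rfl, rfl, rfl, rfl, rfl, rfl, rfl, rfl,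
      rfl⟩ := col_reidemeister_three_left.1 hc
    obtain ⟨A', B', p', q', r', _, _, _, _, _, _, hA', hB', h, rfl, rfl, rfl, rfl, rfl, rfl, h',
      rfl⟩ := col_reidemeister_three_left.1 hc'
    obtain ⟨rfl, k⟩ := List.append_inj h (hA.trans hA'.symm)
    simp only [List.cons.injEq] at k
    obtain ⟨rfl, rfl, rfl, rfl⟩ := k
    rfl

theorem col_unique_right (h : Move l r) (hc : Q.Col r c e d) (hc' : Q.Col r c e' d) : e = e' := by
  cases h with
  | interchange a b b' f g =>
    obtain ⟨A, B, C, m, m', n, n', hA, hB, hC, hf, hg, rfl, rfl, rfl⟩ := col_interchange_right.1 hc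
    obtain ⟨A₁, B₁, C₁, m₁, m₁', n₁, n₁', hA₁, hB₁, hC₁, hf₁, hg₁, h, h', rfl⟩ :=
      col_interchange_right.1 hc'
    obtain ⟨rfl, k₁⟩ := List.append_inj h (hA.trans hA₁.symm)
    obtain ⟨rfl, k₂⟩ := List.append_inj k₁ (hf.length_left.trans hf₁.length_left.symm)
    obtain ⟨-, k₁'⟩ := List.append_inj h' rfl
    obtain ⟨rfl, k₂'⟩ := List.append_inj k₁' (hf.length_right.trans hf₁.length_right.symm)
    rw [k₂']
  | snake_left a b x => rw [hc.1, hc'.1]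
  | snake_right a b x => rw [hc.1, hc'.1]
  | slide_cup a b o x s =>
    obtain ⟨A, B, y, z, hA, hB, rfl, rfl, rfl⟩ := col_slide_cup_right.1 hc
    obtain ⟨A', B', y', z', hA', hB', h, h', rfl⟩ := col_slide_cup_right.1 hc'
    obtain ⟨rfl, k⟩ := List.append_inj h (hA.trans hA'.symm)
    obtain ⟨-, k'⟩ := List.append_inj h' rfl
    simp only [List.cons.injEq] at k k'
    obtain ⟨rfl, rfl⟩ := k
    obtain ⟨-, -, rfl, -⟩ := k'
    rfl
  | slide_cap a b o x s =>
    obtain ⟨A, B, p, q, hA, hB, rfl, rfl, rfl⟩ := col_slide_cap_right.1 hc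
    obtain ⟨A', B', p', q', hA', hB', h, h', rfl⟩ := col_slide_cap_right.1 hc'
    obtain ⟨rfl, k⟩ := List.append_inj h (hA.trans hA'.symm)
    simp only [List.cons.injEq] at k
    obtain ⟨rfl, rfl, -, rfl⟩ := k
    rfl
  | reidemeister_one_cup a b o s => rw [(col_single.1 hc).1, (col_single.1 hc').1]
  | reidemeister_one_cap a b o s => rw [(col_single.1 hc).1, (col_single.1 hc').1]
  | reidemeister_two a b x y s => rw [hc.1, hc'.1]
  | reidemeister_three a b x y z s₁ s₂ s₃ hs =>
    obtain ⟨A, B, p, q, r, _, _, _, _, _, _, hA, hB, rfl, rfl, rfl, rfl, rfl, rfl, rfl, rfl,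
      rfl⟩ := col_reidemeister_three_right.1 hc
    obtain ⟨A', B', p', q', r', _, _, _, _, _, _, hA', hB', h, rfl, rfl, rfl, rfl, rfl, rfl, h',
      rfl⟩ := col_reidemeister_three_right.1 hc'
    obtain ⟨rfl, k⟩ := List.append_inj h (hA.trans hA'.symm)
    simp only [List.cons.injEq] at k
    obtain ⟨rfl, rfl, rfl, rfl⟩ := k
    rfl

end ColorRule

/-! ### Colourings as functions on the points of a diagram. -/

namespace ColorRule

variable {X : Type*} {Q : ColorRule X}

/-- The functions on points that satisfy the relations of the strands and crossings. -/
structure IsPointCol (Q : ColorRule X) (w : List Piece) (f : ℕ × ℕ → X) : Prop where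
  arc : ∀ P R, Arc w P R → f P = f R
  under : ∀ P P' R, Under w P P' R → f P = Q.act true (f P') (f R)

/-- The values of `f` on the first `n` points of level `k`. -/
def level (f : ℕ × ℕ → X) (k n : ℕ) : List X := (List.range n).map fun j => f (k, j)

/-- The values of `f` on the tops of the pieces of `w`, which are numbered from `k`. -/
def levels (f : ℕ × ℕ → X) : ℕ → List Piece → List (List X)
  | _, [] => []
  | k, p :: w => level f (k + 1) p.tgt.length :: levels f (k + 1) w

theorem level_add (f : ℕ × ℕ → X) (k m n : ℕ) :
    level f k (m + n) = level f k m ++ (List.range n).map fun j => f (k, m + j) := by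
  simp [level, List.range_add]

theorem IsPointCol.pieceCol {w : List Piece} {f : ℕ × ℕ → X} (hf : IsPointCol Q w f) {k : ℕ}
    {p : Piece} (hp : w[k]? = some p) :
    Q.PieceCol p (level f k p.src.length) (level f (k + 1) p.tgt.length) := by
  obtain ⟨a, e, b⟩ := p
  have hs : (Piece.src ⟨a, e, b⟩).length = a.length + e.src.length + b.length := by
    simp [Piece.src]; ring
  have ht : (Piece.tgt ⟨a, e, b⟩).length = a.length + e.tgt.length + b.length := by
    simp [Piece.tgt]; ring
  refine ⟨level f k a.length, (List.range b.length).map fun j => f (k, a.length + e.src.length + j),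
    (List.range e.src.length).map fun j => f (k, a.length + j),
    (List.range e.tgt.length).map fun j => f (k + 1, a.length + j), by simp [level], by simp,
    ?_, ?_, ?_⟩
  · cases e with
    | cup o =>
      exact ⟨rfl, f (k + 1, a.length), by
        simp [Elem.tgt, List.range_succ, hf.arc _ _ (Arc.cup k a b o hp)]⟩
    | cap o =>
      exact ⟨⟨f (k, a.length), by
        simp [Elem.src, List.range_succ, hf.arc _ _ (Arc.cap k a b o hp)]⟩, rfl⟩
    | cross x y s =>
      refine ⟨f (k, a.length), f (k, a.length + 1), by simp [Elem.src, List.range_succ], ?_⟩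
      -- The relations in `Under` always describe passage from right to left. If the top end of the
      -- lower strand is on the right of the upper one, the relation is solved for it by `act_not`.
      have inv := Q.act_not true
      cases s
      · have h1 := hf.arc _ _ (Arc.over_false k a b x y hp)
        cases y
        · have h2 := hf.under _ _ _ (Under.false_down k a b x hp)
          simp [Elem.tgt, List.range_succ, topLeft, topRight, h1, h2]
        · have h2 := hf.under _ _ _ (Under.false_up k a b x hp)
          rw [h1] at h2
          simp [Elem.tgt, List.range_succ, topLeft, topRight, h1, h2]
          simpa using (inv _ _).symm
      · have h1 := hf.arc _ _ (Arc.over_true k a b x y hp)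
        cases x
        · have h2 := hf.under _ _ _ (Under.true_down k a b y hp)
          rw [h1] at h2
          simp [Elem.tgt, List.range_succ, topLeft, topRight, h1, h2]
          simpa using (inv _ _).symm
        · have h2 := hf.under _ _ _ (Under.true_up k a b y hp)
          simp [Elem.tgt, List.range_succ, topLeft, topRight, h1, h2]
  · rw [hs, level_add, level_add, List.append_assoc]
  · rw [ht, level_add, level_add, List.append_assoc, level, level]
    congr 1
    · refine List.map_congr_left fun j hj => ?_
      exact (hf.arc _ _ (Arc.left k j _ hp (List.mem_range.1 hj))).symm
    · congr 1
      refine List.map_congr_left fun j hj => ?_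
      exact (hf.arc _ _ (Arc.right k j _ hp (List.mem_range.1 hj))).symm

theorem col_levels {f : ℕ × ℕ → X} {w : List Piece} {a b : List Bool} {k : ℕ}
    (hw : IsTangle a w b)
    (h : ∀ i p, w[i]? = some p →
      Q.PieceCol p (level f (k + i) p.src.length) (level f (k + i + 1) p.tgt.length)) :
    Q.Col w (level f k a.length) (levels f k w) (level f (k + w.length) b.length) := by
  induction w generalizing a k with
  | nil =>
    obtain rfl : a = b := hw
    exact ⟨rfl, rfl⟩
  | cons p w ih =>
    obtain ⟨rfl, hw⟩ := hw
    refine ⟨_, _, rfl, h 0 p rfl, ?_⟩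
    have := ih (k := k + 1) hw fun i q hq => by
      have := h (i + 1) q (by simpa using hq)
      rwa [← Nat.add_assoc, Nat.add_right_comm k i 1] at this
    rwa [List.length_cons, ← Nat.add_assoc, Nat.add_right_comm]

theorem IsPointCol.col {w : List Piece} {f : ℕ × ℕ → X} (hf : IsPointCol Q w f)
    (hw : IsTangle [] w []) : Q.Col w [] (levels f 0 w) [] := by
  have := col_levels (k := 0) hw fun i p hp => by simpa using hf.pieceCol hp
  exact this

/-- Points are recorded on the bottoms of pieces only. The top of each piece is the bottom of the
next one, and the last top is empty because the word is closed. -/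
theorem levels_congr {f g : ℕ × ℕ → X} {w : List Piece} {a : List Bool} {k : ℕ}
    (hw : IsTangle a w [])
    (h : ∀ i p, w[i]? = some p → ∀ j < p.src.length, f (k + i, j) = g (k + i, j)) :
    levels f k w = levels g k w := by
  induction w generalizing a k with
  | nil => rfl
  | cons p w ih =>
    obtain ⟨rfl, hw⟩ := hw
    have h' : ∀ i q, w[i]? = some q → ∀ j < q.src.length,
        f (k + 1 + i, j) = g (k + 1 + i, j) := by
      intro i q hq j hj
      have := h (i + 1) q (by simpa using hq) j hj
      rwa [← Nat.add_assoc, Nat.add_right_comm k i 1] at this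
    rw [levels, levels, ih hw h']
    congr 1
    refine List.map_congr_left fun j hj => ?_
    rw [List.mem_range] at hj
    cases w with
    | nil =>
      have hp : p.tgt = [] := hw
      simp [hp] at hj
    | cons q w =>
      rw [← hw.1] at hj
      exact h' 0 q rfl j hj

theorem levels_map {Y : Type*} (φ : X → Y) (f : ℕ × ℕ → X) (k : ℕ) (w : List Piece) :
    (levels f k w).map (List.map φ) = levels (φ ∘ f) k w := by
  induction w generalizing k with
  | nil => rfl
  | cons p w ih => simp [levels, level, ih]

/-- The colour of a point, if the colours of the levels are given. -/
def colorAt (x₀ : X) (e : List (List X)) (P : ℕ × ℕ) : X :=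
  (e.getD P.1 []).getD P.2 x₀

theorem Col.pieceCol {w : List Piece} {c d : List X} {e : List (List X)} (h : Q.Col w c e d)
    {k : ℕ} {p : Piece} (hp : w[k]? = some p) :
    Q.PieceCol p ((c :: e).getD k []) ((c :: e).getD (k + 1) []) := by
  induction w generalizing c e k with
  | nil => simp at hp
  | cons q w ih =>
    obtain ⟨c', e', rfl, hq, h⟩ := h
    cases k with
    | zero =>
      obtain rfl : q = p := by simpa using hp
      simpa using hq
    | succ k => simpa using ih h (by simpa using hp)

theorem Col.isPointCol {w : List Piece} {c d : List X} {e : List (List X)} (h : Q.Col w c e d)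
    (x₀ : X) : IsPointCol Q w (colorAt x₀ (c :: e)) := by
  constructor
  · intro P R hPR
    cases hPR with
    | left k j p hp hj =>
      obtain ⟨A, B, m, m', hA, hB, hE, h1, h2⟩ := h.pieceCol hp
      rw [← hA] at hj
      simp only [colorAt, h1, h2]
      simp [List.getElem?_append_left hj]
    | right k j p hp hj =>
      obtain ⟨A, B, m, m', hA, hB, hE, h1, h2⟩ := h.pieceCol hp
      simp only [colorAt, h1, h2]
      rw [← hA, ← hE.length_left, ← hE.length_right, ← List.append_assoc, ← List.append_assoc,
        List.getD_append_right _ _ _ _ (by simp), List.getD_append_right _ _ _ _ (by simp)]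
      simp
    | cup k a b o hp =>
      obtain ⟨A, B, _, _, hA, hB, ⟨rfl, z, rfl⟩, h1, h2⟩ := h.pieceCol hp
      simp only [colorAt, h2]
      replace hA : A.length = a.length := hA
      simp [← hA]
    | cap k a b o hp =>
      obtain ⟨A, B, _, _, hA, hB, ⟨⟨z, rfl⟩, rfl⟩, h1, h2⟩ := h.pieceCol hp
      simp only [colorAt, h1]
      replace hA : A.length = a.length := hA
      simp [← hA]
    | over_true k a b x y hp =>
      obtain ⟨A, B, _, _, hA, hB, ⟨p, q, rfl, rfl⟩, h1, h2⟩ := h.pieceCol hp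
      simp only [colorAt, h1, h2]
      replace hA : A.length = a.length := hA
      simp [← hA, topRight]
    | over_false k a b x y hp =>
      obtain ⟨A, B, _, _, hA, hB, ⟨p, q, rfl, rfl⟩, h1, h2⟩ := h.pieceCol hp
      simp only [colorAt, h1, h2]
      replace hA : A.length = a.length := hA
      simp [← hA, topLeft]
  · intro P P' R hP
    have inv : ∀ a b, Q.act true (Q.act false a b) b = a := Q.act_not false
    cases hP with
    | true_up k a b y hp =>
      obtain ⟨A, B, _, _, hA, hB, ⟨p, q, rfl, rfl⟩, h1, h2⟩ := h.pieceCol hp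
      simp only [colorAt, h1, h2]
      replace hA : A.length = a.length := hA
      simp [← hA, topLeft]
    | true_down k a b y hp =>
      obtain ⟨A, B, _, _, hA, hB, ⟨p, q, rfl, rfl⟩, h1, h2⟩ := h.pieceCol hp
      simp only [colorAt, h1, h2]
      replace hA : A.length = a.length := hA
      simp [← hA, topLeft, inv]
    | false_up k a b x hp =>
      obtain ⟨A, B, _, _, hA, hB, ⟨p, q, rfl, rfl⟩, h1, h2⟩ := h.pieceCol hp
      simp only [colorAt, h1, h2]
      replace hA : A.length = a.length := hA
      simp [← hA, topRight, inv]
    | false_down k a b x hp =>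
      obtain ⟨A, B, _, _, hA, hB, ⟨p, q, rfl, rfl⟩, h1, h2⟩ := h.pieceCol hp
      simp only [colorAt, h1, h2]
      replace hA : A.length = a.length := hA
      simp [← hA, topRight]

theorem levels_colorAt_aux {w : List Piece} {c d : List X} {e e₀ : List (List X)}
    (h : Q.Col w c e d) (x₀ : X) :
    levels (colorAt x₀ (e₀ ++ c :: e)) e₀.length w = e := by
  induction w generalizing c e e₀ with
  | nil => exact h.1.symm
  | cons p w ih =>
    obtain ⟨c', e', rfl, hp, h⟩ := h
    have h1 := ih (e₀ := e₀ ++ [c]) h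
    simp only [List.append_assoc, List.singleton_append, List.length_append, List.length_singleton]
      at h1
    rw [levels, h1]
    congr 1
    rw [level, ← hp.length_right]
    refine List.ext_getElem (by simp) fun i h1 h2 => ?_
    simp [colorAt, h2]

theorem Col.levels_colorAt {w : List Piece} {c d : List X} {e : List (List X)}
    (h : Q.Col w c e d) (x₀ : X) : levels (colorAt x₀ (c :: e)) 0 w = e :=
  levels_colorAt_aux (e₀ := []) h x₀

theorem mem_levels {f : ℕ × ℕ → X} {w : List Piece} {a : List Bool} {k : ℕ}
    (hw : IsTangle a w []) {x : X} (h : ∃ l ∈ levels f k w, x ∈ l) :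
    ∃ i p j, w[i]? = some p ∧ j < p.src.length ∧ x = f (k + i, j) := by
  induction w generalizing a k with
  | nil => simp [levels] at h
  | cons p w ih =>
    obtain ⟨rfl, hw⟩ := hw
    obtain ⟨l, hl, hx⟩ := h
    rw [levels, List.mem_cons] at hl
    rcases hl with rfl | hl
    · obtain ⟨j, hj, rfl⟩ := List.mem_map.1 hx
      rw [List.mem_range] at hj
      cases w with
      | nil =>
        have hp : p.tgt = [] := hw
        simp [hp] at hj
      | cons q w =>
        rw [← hw.1] at hj
        exact ⟨1, q, j, rfl, hj, rfl⟩
    · obtain ⟨i, q, j, h1, h2, h3⟩ := ih hw ⟨l, hl, hx⟩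
      exact ⟨i + 1, q, j, by simpa using h1, h2, by rw [h3, Nat.add_right_comm, Nat.add_assoc]⟩

theorem mem_levels_of_point {f : ℕ × ℕ → X} {w : List Piece} {k : ℕ} {a b : List Bool}
    (hw : IsTangle a w b) {i j : ℕ} {p : Piece} (hp : w[i]? = some p) (hj : j < p.src.length) :
    ∃ l ∈ level f k a.length :: levels f k w, f (k + i, j) ∈ l := by
  induction w generalizing a k i with
  | nil => simp at hp
  | cons q w ih =>
    obtain ⟨rfl, hw⟩ := hw
    cases i with
    | zero =>
      obtain rfl : q = p := by simpa using hp
      exact ⟨_, List.mem_cons_self, List.mem_map.2 ⟨j, List.mem_range.2 hj, rfl⟩⟩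
    | succ i =>
      obtain ⟨l, hl, h⟩ := ih (k := k + 1) hw (by simpa using hp)
      refine ⟨l, List.mem_cons_of_mem _ hl, ?_⟩
      rwa [Nat.add_right_comm, Nat.add_assoc] at h

end ColorRule

open Polynomial LaurentPolynomial ColorRule

/-! ### The Alexander module as the module of the universal colouring. -/

section Alexander

/-- The colouring rule of the Alexander module. -/
noncomputable def alexanderRule (N : Type*) [AddCommGroup N] [Module ℤ[T;T⁻¹] N] :
    ColorRule N where
  act s a b := (T (bif s then 1 else -1) : ℤ[T;T⁻¹]) • (a - b) + b
  act_self s a := by simp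
  act_not s a b := by
    cases s <;> simp only [Bool.not_false, Bool.not_true, cond_true, cond_false,
      add_sub_cancel_right, smul_smul, ← T_add] <;> simp
  act_act s r a b c := by
    module

theorem alexanderRule_map {M N : Type*} [AddCommGroup M] [Module ℤ[T;T⁻¹] M] [AddCommGroup N]
    [Module ℤ[T;T⁻¹] N] (φ : M →ₗ[ℤ[T;T⁻¹]] N) (s : Bool) (a b : M) :
    φ ((alexanderRule M).act s a b) = (alexanderRule N).act s (φ a) (φ b) := by
  simp [alexanderRule]

/-- The colouring `e` of a closed diagram in a module is generating and universal, so that the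
module is the Alexander module of the diagram. -/
structure IsUniversal {M : Type} [AddCommGroup M] [Module ℤ[T;T⁻¹] M] (w : List Piece)
    (e : List (List M)) : Prop where
  col : (alexanderRule M).Col w [] e []
  span : Submodule.span ℤ[T;T⁻¹] {x | ∃ l ∈ e, x ∈ l} = ⊤
  lift : ∀ (N : Type) [AddCommGroup N] [Module ℤ[T;T⁻¹] N] (e' : List (List N)),
    (alexanderRule N).Col w [] e' [] →
      ∃ φ : M →ₗ[ℤ[T;T⁻¹]] N, e.map (List.map φ) = e'

theorem finite_points (w : List Piece) : (points w).Finite := by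
  induction w with
  | nil =>
    convert Set.finite_empty
    ext P
    simp [points]
  | cons p w ih =>
    refine ((Set.finite_Iio p.src.length).image (fun j => (0, j)) |>.union
      (ih.image fun P => (P.1 + 1, P.2))).subset ?_
    rintro ⟨k, j⟩ ⟨q, hq, hj⟩
    cases k with
    | zero =>
      obtain rfl : p = q := by simpa using hq
      exact Or.inl ⟨j, hj, rfl⟩
    | succ k => exact Or.inr ⟨(k, j), ⟨q, by simpa using hq, hj⟩, rfl⟩

theorem mem_points {w : List Piece} {k j : ℕ} {p : Piece} (hp : w[k]? = some p)
    (hj : j < p.src.length) : (k, j) ∈ points w := ⟨p, hp, hj⟩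

theorem mem_points_succ {w : List Piece} {a : List Bool} (hw : IsTangle a w []) {k j : ℕ}
    {p : Piece} (hp : w[k]? = some p) (hj : j < p.tgt.length) : (k + 1, j) ∈ points w := by
  induction w generalizing a k with
  | nil => simp at hp
  | cons q w ih =>
    obtain ⟨rfl, hw⟩ := hw
    cases k with
    | zero =>
      obtain rfl : q = p := by simpa using hp
      cases w with
      | nil =>
        have hq : q.tgt = [] := hw
        simp [hq] at hj
      | cons r w => exact ⟨r, rfl, by rwa [hw.1]⟩
    | succ k =>
      obtain ⟨r, hr, h⟩ := ih hw (by simpa using hp)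
      exact ⟨r, by simpa using hr, h⟩

theorem Arc.mem_points {w : List Piece} (hw : IsTangle [] w []) {P R : ℕ × ℕ} (h : Arc w P R) :
    P ∈ points w ∧ R ∈ points w := by
  cases h with
  | left k j p hp hj =>
    exact ⟨KnotTheory.mem_points hp (by simp [Piece.src]; omega),
      mem_points_succ hw hp (by simp [Piece.tgt]; omega)⟩
  | right k j p hp hj =>
    exact ⟨KnotTheory.mem_points hp (by simp [Piece.src]; omega),
      mem_points_succ hw hp (by simp [Piece.tgt]; omega)⟩
  | cup k a b o hp =>
    exact ⟨mem_points_succ hw hp (by simp [Piece.tgt, Elem.tgt]),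
      mem_points_succ hw hp (by simp [Piece.tgt, Elem.tgt])⟩
  | cap k a b o hp =>
    exact ⟨KnotTheory.mem_points hp (by simp [Piece.src, Elem.src]),
      KnotTheory.mem_points hp (by simp [Piece.src, Elem.src])⟩
  | over_true k a b x y hp =>
    exact ⟨KnotTheory.mem_points hp (by simp [Piece.src, Elem.src]),
      mem_points_succ hw hp (by simp [Piece.tgt, Elem.tgt])⟩
  | over_false k a b x y hp =>
    exact ⟨KnotTheory.mem_points hp (by simp [Piece.src, Elem.src]),
      mem_points_succ hw hp (by simp [Piece.tgt, Elem.tgt])⟩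

theorem Under.mem_points {w : List Piece} (hw : IsTangle [] w []) {P P' R : ℕ × ℕ}
    (h : Under w P P' R) : P ∈ points w ∧ P' ∈ points w ∧ R ∈ points w := by
  cases h with
  | true_up k a b y hp =>
    exact ⟨mem_points_succ hw hp (by simp [Piece.tgt, Elem.tgt]),
      KnotTheory.mem_points hp (by simp [Piece.src, Elem.src]),
      KnotTheory.mem_points hp (by simp [Piece.src, Elem.src])⟩
  | true_down k a b y hp =>
    exact ⟨KnotTheory.mem_points hp (by simp [Piece.src, Elem.src]),
      mem_points_succ hw hp (by simp [Piece.tgt, Elem.tgt]),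
      KnotTheory.mem_points hp (by simp [Piece.src, Elem.src])⟩
  | false_up k a b x hp =>
    exact ⟨KnotTheory.mem_points hp (by simp [Piece.src, Elem.src]),
      mem_points_succ hw hp (by simp [Piece.tgt, Elem.tgt]),
      KnotTheory.mem_points hp (by simp [Piece.src, Elem.src])⟩
  | false_down k a b x hp =>
    exact ⟨mem_points_succ hw hp (by simp [Piece.tgt, Elem.tgt]),
      KnotTheory.mem_points hp (by simp [Piece.src, Elem.src]),
      KnotTheory.mem_points hp (by simp [Piece.src, Elem.src])⟩

theorem isPointCol_iff_rows {N : Type*} [AddCommGroup N] [Module ℤ[T;T⁻¹] N] (w : List Piece)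
    (hw : IsTangle [] w []) (f : ℕ × ℕ → N) {m : ℕ} (x : Fin m ≃ points w) :
    IsPointCol (alexanderRule N) w f ↔
      ∀ r, AlexanderRow w r → ∑ i, r (x i) • f (x i) = 0 := by
  have hs : ∀ P ∈ points w, ∀ a : ℤ[T;T⁻¹],
      ∑ i, (Pi.single P a : ℕ × ℕ → ℤ[T;T⁻¹]) (x i) • f (x i) = a • f P := by
    intro P hP a
    rw [Finset.sum_eq_single (x.symm ⟨P, hP⟩)]
    · simp
    · intro i _ hi
      rw [Pi.single_eq_of_ne, zero_smul]
      rintro rfl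
      exact hi (by simp)
    · simp
  constructor
  · rintro ⟨h1, h2⟩ r hr
    cases hr with
    | arc P R h =>
      obtain ⟨hP, hR⟩ := h.mem_points hw
      simp [sub_smul, hs _ hP, hs _ hR, h1 _ _ h]
    | under P P' R h =>
      obtain ⟨hP, hP', hR⟩ := h.mem_points hw
      simp only [Pi.sub_apply, sub_smul, Finset.sum_sub_distrib, hs _ hP, hs _ hP', hs _ hR,
        h2 _ _ _ h]
      simp [alexanderRule, smul_sub]
      abel
  · intro h
    constructor
    · intro P R hPR
      obtain ⟨hP, hR⟩ := hPR.mem_points hw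
      have := h _ (.arc P R hPR)
      simpa [sub_smul, hs _ hP, hs _ hR, sub_eq_zero] using this
    · intro P P' R hPR
      obtain ⟨hP, hP', hR⟩ := hPR.mem_points hw
      have := h _ (.under P P' R hPR)
      simp only [Pi.sub_apply, sub_smul, Finset.sum_sub_distrib, hs _ hP, hs _ hP', hs _ hR,
        one_smul] at this
      rw [sub_sub, sub_eq_zero] at this
      rw [this]
      simp [alexanderRule, smul_sub]
      abel

/-- The module is the free module on the points modulo the rows of the Alexander matrix, coloured by
the classes of the basis vectors. A colouring in N is a function on the points that annihilates all
rows, hence a linear map from this quotient. All relations among the basis classes are combinations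
of rows, so minors of relations and minors of rows generate the same ideal. -/
theorem exists_isUniversal {w : List Piece} (hw : IsTangle [] w []) (hne : (points w).Nonempty) :
    ∃ (M : Type) (_ : AddCommGroup M) (_ : Module ℤ[T;T⁻¹] M) (e : List (List M)) (m : ℕ)
      (x : Fin (m + 1) → M), IsUniversal w e ∧ Submodule.span ℤ[T;T⁻¹] (Set.range x) = ⊤ ∧
        alexanderIdeal w = minorIdeal x := by
  classical
  have := (finite_points w).fintype
  obtain ⟨m, hm⟩ := Nat.exists_eq_add_one.2 ((Set.ncard_pos (finite_points w)).2 hne)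
  let p : Fin (m + 1) ≃ points w := (Fintype.equivFinOfCardEq (by
    rw [← hm, Set.ncard_eq_toFinset_card', Set.toFinset_card])).symm
  let S : Set (Fin (m + 1) → ℤ[T;T⁻¹]) := {s | ∃ r, AlexanderRow w r ∧ s = fun i => r (p i)}
  let K := Submodule.span ℤ[T;T⁻¹] S
  let x : Fin (m + 1) → (Fin (m + 1) → ℤ[T;T⁻¹]) ⧸ K := fun i => K.mkQ (Pi.single i 1)
  have hsum : ∀ s : Fin (m + 1) → ℤ[T;T⁻¹], ∑ i, s i • x i = K.mkQ s := by
    intro s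
    simp only [x, ← map_smul, ← map_sum]
    congr 1
    ext j
    simp [Finset.sum_apply, Pi.single_apply]
  let f : ℕ × ℕ → (Fin (m + 1) → ℤ[T;T⁻¹]) ⧸ K := fun P =>
    if h : P ∈ points w then x (p.symm ⟨P, h⟩) else 0
  have hfx : ∀ i, f (p i) = x i := by
    intro i
    simp [f]
  have hf : IsPointCol (alexanderRule _) w f := by
    rw [isPointCol_iff_rows w hw f p]
    intro r hr
    simp only [hfx]
    rw [hsum fun i => r (p i)]
    exact (Submodule.Quotient.mk_eq_zero K).2 (Submodule.subset_span ⟨r, hr, rfl⟩)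
  have hx : Submodule.span ℤ[T;T⁻¹] (Set.range x) = ⊤ := by
    rw [eq_top_iff]
    rintro z -
    obtain ⟨s, rfl⟩ := K.mkQ_surjective z
    rw [← hsum]
    exact Submodule.sum_mem _ fun i _ => Submodule.smul_mem _ _ (Submodule.subset_span ⟨i, rfl⟩)
  refine ⟨_, inferInstance, inferInstance, levels f 0 w, m, x, ⟨hf.col hw, ?_, ?_⟩, hx, ?_⟩
  · rw [eq_top_iff, ← hx]
    refine Submodule.span_mono ?_
    rintro _ ⟨i, rfl⟩
    obtain ⟨q, hq, hj⟩ := (p i).2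
    obtain ⟨l, hl, h⟩ := mem_levels_of_point (f := f) (k := 0) hw hq hj
    rw [Nat.zero_add, hfx] at h
    rw [List.mem_cons] at hl
    rcases hl with rfl | hl
    · simp [level] at h
    · exact ⟨l, hl, h⟩
  · intro N _ _ e' he'
    have hg := he'.isPointCol 0
    set g := colorAt (0 : N) ([] :: e') with hgdef
    have hK : K ≤ LinearMap.ker (Fintype.linearCombination ℤ[T;T⁻¹] fun i => g (p i)) := by
      refine Submodule.span_le.2 ?_
      rintro _ ⟨r, hr, rfl⟩
      exact (isPointCol_iff_rows w hw g p).1 hg r hr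
    refine ⟨K.liftQ _ hK, ?_⟩
    rw [levels_map, ← he'.levels_colorAt 0]
    refine levels_congr hw fun i q hq j hj => ?_
    rw [Nat.zero_add]
    have hP : (i, j) ∈ points w := ⟨q, hq, hj⟩
    simp [f, hP, x, ← hgdef, Fintype.linearCombination_apply, Pi.single_apply]
  · have hker : ∀ r : Fin (m + 1) → ℤ[T;T⁻¹], ∑ i, r i • x i = 0 ↔ r ∈ K := by
      intro r
      rw [hsum]
      exact Submodule.Quotient.mk_eq_zero K
    -- Rows are relations, which gives one inclusion; the other is `det_mem_span_of_rows_mem_span`.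
    refine le_antisymm (Ideal.span_le.2 ?_) (Ideal.span_le.2 ?_)
    · rintro _ ⟨n, r, c, hn, hr, hc, rfl⟩
      refine Ideal.subset_span ⟨n, fun k i => r k (p i), fun j => p.symm ⟨c j, hc j⟩, ?_, ?_, ?_⟩
      · rw [← hn, hm, Fintype.card_fin]
      · intro k
        rw [hker]
        exact Submodule.subset_span ⟨r k, hr k, rfl⟩
      · simp
    · rintro _ ⟨n, r, c, hn, hr, rfl⟩
      refine det_mem_span_of_rows_mem_span S c _ ?_ r fun k => (hker _).1 (hr k)
      intro r hr
      choose r' hr' h using hr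
      refine Ideal.subset_span ⟨n, r', fun j => p (c j), ?_, hr', fun j => (p (c j)).2, ?_⟩
      · rw [hm, ← hn, Fintype.card_fin]
      · simp [h]

end Alexander

/-! ### Invariance of the Alexander ideal. -/

theorem map_eq_self_iff {X : Type*} {φ : X → X} {l : List X} :
    l.map φ = l ↔ ∀ x ∈ l, φ x = x := by
  induction l with
  | nil => simp
  | cons a l ih => simp [ih]

theorem isTangle_append {a b : List Bool} {v w : List Piece} :
    IsTangle a (v ++ w) b ↔ ∃ c, IsTangle a v c ∧ IsTangle c w b := by
  induction v generalizing a with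
  | nil =>
    constructor
    · exact fun h => ⟨a, rfl, h⟩
    · rintro ⟨c, rfl, h⟩
      exact h
  | cons p v ih =>
    constructor
    · rintro ⟨h, h'⟩
      obtain ⟨c, h1, h2⟩ := ih.1 h'
      exact ⟨c, ⟨h, h1⟩, h2⟩
    · rintro ⟨c, ⟨h, h1⟩, h2⟩
      exact ⟨h, ih.2 ⟨c, h1, h2⟩⟩

/-- After `u`, the words `l` and `r` admit the same colourings of their boundaries, and these
determine the colourings of their interiors. -/
structure SameColorings (u l r : List Piece) : Prop where
  left : ∀ {X : Type} {Q : ColorRule X} {c d : List X} {e₁ e : List (List X)},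
    Q.Col u [] e₁ c → Q.Col l c e d → ∃ e', Q.Col r c e' d
  right : ∀ {X : Type} {Q : ColorRule X} {c d : List X} {e₁ e : List (List X)},
    Q.Col u [] e₁ c → Q.Col r c e d → ∃ e', Q.Col l c e' d
  unique_left : ∀ {X : Type} {Q : ColorRule X} {c d : List X} {e e' : List (List X)},
    Q.Col l c e d → Q.Col l c e' d → e = e'
  unique_right : ∀ {X : Type} {Q : ColorRule X} {c d : List X} {e e' : List (List X)},
    Q.Col r c e d → Q.Col r c e' d → e = e'

theorem SameColorings.symm {u l r : List Piece} (h : SameColorings u l r) :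
    SameColorings u r l :=
  ⟨h.right, h.left, h.unique_right, h.unique_left⟩

/-- An empty side of a move does not restrict the number of colours at its boundary. The coloured
word `u` below supplies that number. -/
theorem Move.sameColorings {u l r v : List Piece} (h : Move l r)
    (hw : IsTangle [] (u ++ l ++ v) []) : SameColorings u l r where
  left _ hl := exists_col_of_left h hl
  right hu hr := by
    obtain ⟨b, hw, -⟩ := isTangle_append.1 hw
    obtain ⟨a, h1, h2⟩ := isTangle_append.1 hw
    exact exists_col_of_right h h2 (hu.length_right h1 rfl) hr
  unique_left := col_unique_left h
  unique_right := col_unique_right h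

/-- With this trivial replacement, `IsUniversal.exists_linearEquiv` says that the universal module
of a single word is unique. -/
theorem sameColorings_nil (u : List Piece) : SameColorings u [] [] where
  left _ h := ⟨_, h⟩
  right _ h := ⟨_, h⟩
  unique_left h h' := h.1.trans h'.1.symm
  unique_right h h' := h.1.trans h'.1.symm

theorem col_append₃ {X : Type*} {Q : ColorRule X} {u l v : List Piece} {c d : List X}
    {e : List (List X)} : Q.Col (u ++ l ++ v) c e d ↔ ∃ e₁ e₂ e₃ c' d', e = e₁ ++ e₂ ++ e₃ ∧
      Q.Col u c e₁ c' ∧ Q.Col l c' e₂ d' ∧ Q.Col v d' e₃ d := by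
  rw [col_append]
  constructor
  · rintro ⟨e', e₃, d', rfl, h, h3⟩
    obtain ⟨e₁, e₂, c', rfl, h1, h2⟩ := col_append.1 h
    exact ⟨e₁, e₂, e₃, c', d', rfl, h1, h2, h3⟩
  · rintro ⟨e₁, e₂, e₃, c', d', rfl, h1, h2, h3⟩
    exact ⟨_, _, d', rfl, col_append.2 ⟨_, _, c', rfl, h1, h2⟩, h3⟩

section Alexander

variable {M M' : Type} [AddCommGroup M] [Module ℤ[T;T⁻¹] M] [AddCommGroup M']
  [Module ℤ[T;T⁻¹] M'] {u l r v : List Piece}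

theorem IsUniversal.hom_eq_id {w : List Piece} {e : List (List M)} (h : IsUniversal w e)
    (φ : M →ₗ[ℤ[T;T⁻¹]] M) (hφ : e.map (List.map φ) = e) : φ = LinearMap.id := by
  refine LinearMap.ext_on h.span ?_
  rintro x ⟨l, hl, hx⟩
  have h1 : List.map φ l = l := (map_eq_self_iff.1 hφ) l hl
  exact (map_eq_self_iff.1 h1) x hx

/-- Keeping the levels of `u` and `v` and replacing the inner ones turns each universal colouring
into a colouring of the other word, whence φ and ψ by universality. The composites fix the levels
outside. They also fix the inner levels, because these are determined by their boundary, so the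
composites are identities by `IsUniversal.hom_eq_id`. -/
theorem IsUniversal.exists_linearEquiv {e : List (List M)} {e' : List (List M')}
    (h : SameColorings u l r) (he : IsUniversal (u ++ l ++ v) e)
    (he' : IsUniversal (u ++ r ++ v) e') : Nonempty (M ≃ₗ[ℤ[T;T⁻¹]] M') := by
  obtain ⟨e₁, e₂, e₃, c, d, rfl, h1, h2, h3⟩ := col_append₃.1 he.col
  obtain ⟨e₁', e₂', e₃', c', d', rfl, h1', h2', h3'⟩ := col_append₃.1 he'.col
  obtain ⟨f, hf⟩ := h.left h1 h2
  obtain ⟨f', hf'⟩ := h.right h1' h2'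
  obtain ⟨φ, hφ⟩ := he.lift M' _ (col_append₃.2 ⟨_, _, _, _, _, rfl, h1', hf', h3'⟩)
  obtain ⟨ψ, hψ⟩ := he'.lift M _ (col_append₃.2 ⟨_, _, _, _, _, rfl, h1, hf, h3⟩)
  rw [List.map_append, List.map_append] at hφ hψ
  obtain ⟨hφ', hφ₃⟩ := List.append_inj hφ (by
    simp [h1.length, h1'.length, h2.length, hf'.length])
  obtain ⟨hφ₁, hφ₂⟩ := List.append_inj hφ' (by simp [h1.length, h1'.length])
  obtain ⟨hψ', hψ₃⟩ := List.append_inj hψ (by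
    simp [h1.length, h1'.length, h2'.length, hf.length])
  obtain ⟨hψ₁, hψ₂⟩ := List.append_inj hψ' (by simp [h1.length, h1'.length])
  have hc : c.map φ = c' := by
    have := h1.map φ (alexanderRule_map φ)
    rw [hφ₁] at this
    exact this.top_unique h1'
  have hc' : c'.map ψ = c := by
    have := h1'.map ψ (alexanderRule_map ψ)
    rw [hψ₁] at this
    exact this.top_unique h1
  have hd : d.map φ = d' := by
    have := h2.map φ (alexanderRule_map φ)
    rw [hφ₂, hc] at this
    exact this.top_unique hf'
  have hd' : d'.map ψ = d := by
    have := h2'.map ψ (alexanderRule_map ψ)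
    rw [hψ₂, hc'] at this
    exact this.top_unique hf
  have k : f'.map (List.map ψ) = e₂ := by
    have := hf'.map ψ (alexanderRule_map ψ)
    rw [hc', hd'] at this
    exact h.unique_left this h2
  have k' : f.map (List.map φ) = e₂' := by
    have := hf.map φ (alexanderRule_map φ)
    rw [hc, hd] at this
    exact h.unique_right this h2'
  have comp : ∀ {A B C : Type} (α : A → B) (β : B → C) (s : List (List A)),
      s.map (List.map (β ∘ α)) = (s.map (List.map α)).map (List.map β) := by
    intro A B C α β s
    simp
  refine ⟨LinearEquiv.ofLinearMap φ ψ (he'.hom_eq_id _ ?_) (he.hom_eq_id _ ?_)⟩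
  · simp only [LinearMap.coe_comp, comp, List.map_append, hψ₁, hψ₂, hψ₃, hφ₁, hφ₃, k']
  · simp only [LinearMap.coe_comp, comp, List.map_append, hφ₁, hφ₂, hφ₃, hψ₁, hψ₃, k]

/-- This frees the computation from the points of the diagram: any finite generating family of any
universal module will do. -/
theorem IsUniversal.alexanderIdeal_eq {w : List Piece} (hw : IsTangle [] w [])
    (hne : (points w).Nonempty) {e : List (List M)} (he : IsUniversal w e) {ι : Type*} [Fintype ι]
    [Nonempty ι] (x : ι → M) (hx : Submodule.span ℤ[T;T⁻¹] (Set.range x) = ⊤) :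
    alexanderIdeal w = minorIdeal x := by
  obtain ⟨N, _, _, f, m, y, hf, hy, h⟩ := exists_isUniversal hw hne
  have h1 : w ++ [] ++ [] = w := by simp
  rw [← h1] at hf he
  obtain ⟨φ⟩ := he.exists_linearEquiv (sameColorings_nil w) hf
  rw [h, ← minorIdeal_map_linearEquiv φ x]
  refine minorIdeal_eq _ _ hy ?_
  rw [Set.range_comp, ← LinearEquiv.coe_coe, ← LinearMap.map_span, hx, Submodule.map_top,
    LinearEquiv.range]

theorem alexanderIdeal_eq_of_sameColorings (h : SameColorings u l r)
    (hl : IsTangle [] (u ++ l ++ v) []) (hr : IsTangle [] (u ++ r ++ v) [])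
    (hnl : (points (u ++ l ++ v)).Nonempty) (hnr : (points (u ++ r ++ v)).Nonempty) :
    alexanderIdeal (u ++ l ++ v) = alexanderIdeal (u ++ r ++ v) := by
  obtain ⟨M, _, _, e, m, x, he, hx, hM⟩ := exists_isUniversal hl hnl
  obtain ⟨N, _, _, f, n, y, hf, hy, hN⟩ := exists_isUniversal hr hnr
  obtain ⟨φ⟩ := he.exists_linearEquiv h hf
  rw [hM, hN, ← minorIdeal_map_linearEquiv φ x]
  refine minorIdeal_eq _ _ ?_ hy
  rw [Set.range_comp, ← LinearEquiv.coe_coe, ← LinearMap.map_span, hx, Submodule.map_top,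
    LinearEquiv.range]

theorem Step.alexanderIdeal_eq {D D' : KnotDiagram} (h : Step D D') :
    alexanderIdeal D.word = alexanderIdeal D'.word := by
  obtain ⟨u, l, r, v, hm, hl, hr⟩ := h
  have h1 := D.isTangle
  have h2 := D'.isTangle
  have h3 := D.nonempty
  have h4 := D'.nonempty
  rw [hl] at h1 h3 ⊢
  rw [hr] at h2 h4 ⊢
  exact alexanderIdeal_eq_of_sameColorings (hm.sameColorings h1) h1 h2 h3 h4

/-- The first elementary ideal is a knot invariant. -/
theorem alexanderIdeal_eq_of_knot_eq {D D' : KnotDiagram} (h : D.knot = D'.knot) :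
    alexanderIdeal D.word = alexanderIdeal D'.word := by
  have h' : Relation.EqvGen Step D D' := Quotient.exact h
  clear h
  induction h' with
  | rel _ _ h => exact h.alexanderIdeal_eq
  | refl => rfl
  | symm _ _ _ ih => exact ih.symm
  | trans _ _ _ _ _ ih ih' => exact ih.trans ih'

end Alexander

/-! ### Connectedness, read off from constant colourings. -/

section Connected

/-- The colouring rule for which colours do not change at crossings. -/
def trivialRule (X : Type*) : ColorRule X where
  act _ a _ := a
  act_self _ _ := rfl
  act_not _ _ _ := rfl
  act_act _ _ _ _ _ := rfl

/-- All the colourings of the components of a diagram are constant. -/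
def HasConstantColorings (w : List Piece) : Prop :=
  ∀ e, (trivialRule Bool).Col w [] e [] → ∃ z, ∀ l ∈ e, ∀ x ∈ l, x = z

/-- A colouring by the trivial rule is constant on components, and the indicator function of a
component is such a colouring. In this form connectedness can be transported along moves and
crossing changes. -/
theorem connected_iff {w : List Piece} (hw : IsTangle [] w []) :
    (∀ P ∈ points w, ∀ Q ∈ points w, Relation.EqvGen (Joined w) P Q) ↔
      HasConstantColorings w := by
  classical
  constructor
  · intro h e he
    have hf := he.isPointCol false
    have hj : ∀ P Q, Relation.EqvGen (Joined w) P Q →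
        colorAt false ([] :: e) P = colorAt false ([] :: e) Q := by
      intro P Q hPQ
      induction hPQ with
      | rel _ _ h =>
        rcases h with h | ⟨R, h⟩
        · exact hf.arc _ _ h
        · exact hf.under _ _ _ h
      | refl => rfl
      | symm _ _ _ ih => exact ih.symm
      | trans _ _ _ _ _ ih ih' => exact ih.trans ih'
    by_cases hne : (points w).Nonempty
    · obtain ⟨P, hP⟩ := hne
      refine ⟨colorAt false ([] :: e) P, fun l hl x hx => ?_⟩
      rw [← he.levels_colorAt false] at hl
      obtain ⟨i, p, j, hp, hj', rfl⟩ := mem_levels hw ⟨l, hl, hx⟩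
      exact hj _ _ (h _ (mem_points (by simpa using hp) hj') _ hP)
    · refine ⟨false, fun l hl x hx => ?_⟩
      rw [← he.levels_colorAt false] at hl
      obtain ⟨i, p, j, hp, hj', rfl⟩ := mem_levels hw ⟨l, hl, hx⟩
      exact (hne ⟨_, mem_points hp hj'⟩).elim
  · intro h P hP Q hQ
    let f : ℕ × ℕ → Bool := fun R => decide (Relation.EqvGen (Joined w) P R)
    have key : ∀ R S, Joined w R S → f R = f S := by
      intro R S hRS
      simp only [f, decide_eq_decide]
      exact ⟨fun h => h.trans _ _ _ (.rel _ _ hRS),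
        fun h => h.trans _ _ _ (.symm _ _ (.rel _ _ hRS))⟩
    have hf : IsPointCol (trivialRule Bool) w f :=
      ⟨fun R S h => key _ _ (Or.inl h), fun R S S' h => key _ _ (Or.inr ⟨S', h⟩)⟩
    obtain ⟨z, hz⟩ := h _ (hf.col hw)
    have hpt : ∀ R ∈ points w, f R = z := by
      rintro R ⟨p, hp, hj⟩
      obtain ⟨l, hl, h⟩ := mem_levels_of_point (f := f) (k := 0) hw hp hj
      rw [Nat.zero_add] at h
      rw [List.mem_cons] at hl
      rcases hl with rfl | hl
      · simp [level] at h
      · exact hz l hl _ h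
    have h1 := (hpt Q hQ).trans (hpt P hP).symm
    have h2 : f P = true := by simpa [f] using Relation.EqvGen.refl P
    rw [h2] at h1
    simpa [f] using h1

theorem HasConstantColorings.of_sameColorings {u l r v : List Piece} (h : SameColorings u l r)
    (hl : HasConstantColorings (u ++ l ++ v)) : HasConstantColorings (u ++ r ++ v) := by
  intro e he
  obtain ⟨e₁, e₂, e₃, c, d, rfl, h1, h2, h3⟩ := col_append₃.1 he
  obtain ⟨f, hf⟩ := h.right h1 h2
  obtain ⟨z, hz⟩ := hl _ (col_append₃.2 ⟨_, _, _, _, _, rfl, h1, hf, h3⟩)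
  -- Collapsing all colours to `z` respects the trivial rule and fixes the levels outside `e₂`, as
  -- well as `c` and `d`. So `e₂` and its collapse have the same boundary, and uniqueness makes them
  -- equal.
  let φ : Bool → Bool := fun _ => z
  have hφ : ∀ s a b, φ ((trivialRule Bool).act s a b) = (trivialRule Bool).act s (φ a) (φ b) :=
    fun _ _ _ => rfl
  have hmap : ∀ g : List (List Bool), (∀ l ∈ g, ∀ x ∈ l, x = z) → g.map (List.map φ) = g := by
    intro g hg
    exact map_eq_self_iff.2 fun l hl => map_eq_self_iff.2 fun x hx => (hg l hl x hx).symm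
  have h1' := h1.map φ hφ
  rw [hmap e₁ fun l hl => hz l (by simp [hl])] at h1'
  have hc : c.map φ = c := h1'.top_unique h1
  have hf' := hf.map φ hφ
  rw [hc, hmap f fun l hl => hz l (by simp [hl])] at hf'
  have hd : d.map φ = d := hf'.top_unique hf
  have h2' := h2.map φ hφ
  rw [hc, hd] at h2'
  have he₂ := h.unique_right h2' h2
  refine ⟨z, fun l hl x hx => ?_⟩
  rw [List.mem_append, List.mem_append] at hl
  rcases hl with (hl | hl) | hl
  · exact hz l (by simp [hl]) x hx
  · exact ((map_eq_self_iff.1 ((map_eq_self_iff.1 he₂) l hl)) x hx).symm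
  · exact hz l (by simp [hl]) x hx

/-- The trivial rule does not see which strand of a crossing is the upper one. -/
theorem CrossingChanges.col {n : ℕ} {w w' : List Piece} (h : CrossingChanges n w w') {X : Type*}
    {c d : List X} {e : List (List X)} (hc : (trivialRule X).Col w c e d) :
    (trivialRule X).Col w' c e d := by
  induction h generalizing c e with
  | nil => exact hc
  | keep n w w' p h ih =>
    obtain ⟨c', e', rfl, hp, hc⟩ := hc
    exact ⟨c', e', rfl, hp, ih hc⟩
  | change n w w' a b x y s h ih =>
    obtain ⟨c', e', rfl, ⟨A, B, _, _, hA, hB, ⟨p, q, rfl, rfl⟩, rfl, rfl⟩, hc⟩ := hc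
    refine ⟨_, e', rfl, ⟨A, B, _, _, hA, hB, ⟨p, q, rfl, rfl⟩, rfl, ?_⟩, ih hc⟩
    cases s <;> rfl

theorem nonempty_points {w : List Piece} (hw : IsTangle [] w []) (hne : w ≠ []) :
    (points w).Nonempty := by
  obtain ⟨p, w, rfl⟩ := List.exists_cons_of_ne_nil hne
  obtain ⟨hp, hw⟩ := hw
  obtain ⟨a, e, b⟩ := p
  have hsrc : e.src = [] := by
    have : a ++ e.src ++ b = [] := hp
    simp at this
    exact this.2.1
  cases e with
  | cup o =>
    exact ⟨_, mem_points_succ (w := ⟨a, .cup o, b⟩ :: w) ⟨hp, hw⟩ (k := 0) (j := 0) rfl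
      (by simp [Piece.tgt, Elem.tgt])⟩
  | cap o => simp [Elem.src] at hsrc
  | cross x y s => simp [Elem.src] at hsrc

/-- Since moves preserve connectedness, performing one on a knot diagram only requires checking that
the new word is a nonempty closed tangle. -/
theorem KnotDiagram.exists_of_move {D : KnotDiagram} {u l r v : List Piece}
    (hD : D.word = u ++ l ++ v) (hm : Move l r ∨ Move r l) (hr : IsTangle [] (u ++ r ++ v) [])
    (hne : u ++ r ++ v ≠ []) : ∃ D' : KnotDiagram, D'.word = u ++ r ++ v ∧ D'.knot = D.knot := by
  have hl := D.isTangle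
  rw [hD] at hl
  have hs : SameColorings u l r := by
    rcases hm with hm | hm
    · exact hm.sameColorings hl
    · exact (hm.sameColorings hr).symm
  have hc := (connected_iff D.isTangle).1 D.connected
  rw [hD] at hc
  let D' : KnotDiagram := ⟨u ++ r ++ v, hr, nonempty_points hr hne,
    (connected_iff hr).2 (hc.of_sameColorings hs)⟩
  refine ⟨D', rfl, Quotient.sound ?_⟩
  rcases hm with hm | hm
  · exact .symm _ _ (.rel _ _ ⟨u, l, r, v, hm, hD, rfl⟩)
  · exact .rel _ _ ⟨u, r, l, v, hm, rfl, hD⟩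

end Connected

/-! ### Generators of the Alexander module and the number of maxima. -/

/-- The piece contains a local minimum. -/
def Piece.isCup (p : Piece) : Bool :=
  match p.elem with
  | .cup _ => true
  | _ => false

/-- A minimum adds two strands, a maximum removes two, and a crossing preserves their number. -/
theorem IsTangle.countP_isCup {a b : List Bool} {w : List Piece} (hw : IsTangle a w b) :
    a.length + 2 * w.countP Piece.isCup = b.length + 2 * w.countP Piece.isCap := by
  induction w generalizing a with
  | nil =>
    obtain rfl : a = b := hw
    rfl
  | cons p w ih =>
    obtain ⟨rfl, hw⟩ := hw
    have := ih hw
    obtain ⟨l, e, r⟩ := p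
    cases e <;>
    simp [Piece.isCup, Piece.isCap, Piece.src, Piece.tgt, Elem.src, Elem.tgt,
      List.countP_cons] at this ⊢ <;> omega

section Span

variable {M : Type*} [AddCommGroup M] [Module ℤ[T;T⁻¹] M]

theorem alexanderRule_act_mem (S : Submodule ℤ[T;T⁻¹] M) {s : Bool} {x y : M} (hx : x ∈ S)
    (hy : y ∈ S) : (alexanderRule M).act s x y ∈ S :=
  S.add_mem (S.smul_mem _ (S.sub_mem hx hy)) hy

theorem pieceCol_mem (S : Submodule ℤ[T;T⁻¹] M) {p : Piece} {c d : List M}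
    (h : (alexanderRule M).PieceCol p c d) (hp : p.isCup = false) (hc : ∀ x ∈ c, x ∈ S) :
    ∀ x ∈ d, x ∈ S := by
  obtain ⟨l, e, r⟩ := p
  obtain ⟨A, B, m, m', -, -, hE, rfl, rfl⟩ := h
  have hm' : ∀ x ∈ m', x ∈ S := by
    cases e with
    | cup o => simp [Piece.isCup] at hp
    | cap o => obtain ⟨-, rfl⟩ := hE; simp
    | cross x y s =>
      obtain ⟨p, q, rfl, rfl⟩ := hE
      have h1 : p ∈ S := hc p (by simp)
      have h2 : q ∈ S := hc q (by simp)
      have h3 := fun s => alexanderRule_act_mem S (s := s) h1 h2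
      have h4 := fun s => alexanderRule_act_mem S (s := s) h2 h1
      cases s <;> simp [topLeft, topRight, h1, h2, h3, h4]
  intro x hx
  simp only [List.mem_append] at hx hc
  rcases hx with hx | hx | hx
  · exact hc x (Or.inl hx)
  · exact hm' x hx
  · exact hc x (Or.inr (Or.inr hx))

/-- The colours of the minima generate all colours. -/
theorem exists_finset_span (S : Submodule ℤ[T;T⁻¹] M) {w : List Piece} {c d : List M}
    {e : List (List M)} (h : (alexanderRule M).Col w c e d) (hc : ∀ x ∈ c, x ∈ S) :
    ∃ t : Finset M, t.card ≤ w.countP Piece.isCup ∧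
      ∀ l ∈ e, ∀ x ∈ l, x ∈ S ⊔ Submodule.span ℤ[T;T⁻¹] t := by
  classical
  -- The submodule varies because each minimum adjoins its colour to `S`; maxima and crossings
  -- create no colour outside `S`.
  induction w generalizing S c e with
  | nil => exact ⟨∅, by simp, by simp [h.1]⟩
  | cons p w ih =>
    obtain ⟨c', e', rfl, hp, h⟩ := h
    by_cases hcup : p.isCup = true
    · obtain ⟨l, f, r⟩ := p
      obtain ⟨A, B, m, m', -, -, hE, rfl, rfl⟩ := hp
      cases f with
      | cap o => simp [Piece.isCup] at hcup
      | cross x y s => simp [Piece.isCup] at hcup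
      | cup o =>
        obtain ⟨rfl, z, rfl⟩ := hE
        have hc' : ∀ x ∈ A ++ ([z, z] ++ B), x ∈ S ⊔ Submodule.span ℤ[T;T⁻¹] {z} := by
          intro x hx
          by_cases hxz : x = z
          · subst hxz
            exact Submodule.mem_sup_right (Submodule.mem_span_singleton_self x)
          · exact Submodule.mem_sup_left (hc x (by simpa [hxz] using hx))
        obtain ⟨t, ht, h'⟩ := ih _ h hc'
        rw [sup_assoc, ← Submodule.span_union, Set.singleton_union, ← Finset.coe_insert] at h'
        refine ⟨insert z t, ?_, ?_⟩
        · rw [List.countP_cons_of_pos hcup]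
          exact (Finset.card_insert_le _ _).trans (by omega)
        · intro l hl x hx
          rcases List.mem_cons.1 hl with rfl | hl
          · refine (sup_le_sup_left (Submodule.span_mono ?_) S) (hc' x hx)
            simp
          · exact h' l hl x hx
    · have hc' := pieceCol_mem S hp (by simpa using hcup) hc
      obtain ⟨t, ht, h'⟩ := ih S h hc'
      refine ⟨t, by rwa [List.countP_cons_of_neg hcup], ?_⟩
      intro l hl x hx
      rcases List.mem_cons.1 hl with rfl | hl
      · exact Submodule.mem_sup_left (hc' x hx)
      · exact h' l hl x hx

end Span

/-- A diagram with at most one maximum has a trivial Alexander polynomial. -/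
theorem alexanderIdeal_eq_top (D : KnotDiagram) (h : D.word.countP Piece.isCap ≤ 1) :
    alexanderIdeal D.word = ⊤ := by
  obtain ⟨M, _, _, e, m, y, he, hy, -⟩ := exists_isUniversal D.isTangle D.nonempty
  obtain ⟨t, ht, h'⟩ := exists_finset_span ⊥ he.col (by simp)
  have hcount := D.isTangle.countP_isCup
  obtain ⟨z, hz⟩ : ∃ z : M, (t : Set M) ⊆ {z} := by
    have h1 : t.card ≤ 1 := by
      simp at hcount
      omega
    obtain ⟨z, hz⟩ := Finset.card_le_one_iff_subset_singleton.1 h1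
    exact ⟨z, by exact_mod_cast hz⟩
  rw [he.alexanderIdeal_eq D.isTangle D.nonempty (fun _ : Fin 1 => z), Ideal.eq_top_iff_one]
  -- With a single generator the minors have size zero, and the empty determinant is 1.
  · exact Ideal.subset_span ⟨0, Fin.elim0, Fin.elim0, by simp, fun k => k.elim0, by simp⟩
  · rw [eq_top_iff, ← he.span]
    refine Submodule.span_le.2 ?_
    rintro x ⟨l, hl, hx⟩
    have := h' l hl x hx
    rw [bot_sup_eq] at this
    refine Submodule.span_mono ?_ this
    simpa using hz

/-! ### The plat diagrams and the crossing change that unknots them. -/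

/-- A crossing of the two middle ones of four strands. -/
def twist (s : Bool) : Piece := ⟨[false], .cross true true s, [false]⟩

/-- The part of the diagram of `plat` above the two minima. -/
def platTop (n : ℕ) (s : Bool) : List Piece :=
  List.replicate (n + 1) (twist true) ++
    ([⟨[], .cross false true true, [true, false]⟩, ⟨[], .cross true false s, [true, false]⟩] ++
      (List.replicate n (twist false) ++ [⟨[], .cap false, [true, false]⟩, ⟨[], .cap true, []⟩]))

/-- The plat closure of the braid `σ₂ ^ (n + 1) * (σ₁ * σ₁ ^ ±1) * σ₂ ^ (-n)`. -/
def plat (n : ℕ) (s : Bool) : List Piece :=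
  [⟨[], .cup false, []⟩, ⟨[false, true], .cup true, []⟩] ++ platTop n s

theorem isTangle_replicate_twist (n : ℕ) (s : Bool) :
    IsTangle [false, true, true, false] (List.replicate n (twist s))
      [false, true, true, false] := by
  induction n with
  | zero => rfl
  | succ n ih => exact ⟨rfl, ih⟩

theorem isTangle_plat (n : ℕ) (s : Bool) : IsTangle [] (plat n s) [] := by
  have h := isTangle_append.2 ⟨[false, true, true, false], isTangle_replicate_twist n false,
    show IsTangle _ [⟨[], .cap false, [true, false]⟩, ⟨[], .cap true, []⟩] [] from ⟨rfl, rfl, rfl⟩⟩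
  have h' : IsTangle [false, true, true, false] (platTop n s) [] :=
    isTangle_append.2 ⟨_, isTangle_replicate_twist _ _, rfl, rfl, h⟩
  exact ⟨rfl, rfl, h'⟩

theorem CrossingChanges.refl (w : List Piece) : CrossingChanges 0 w w := by
  induction w with
  | nil => exact .nil
  | cons p w ih => exact .keep _ _ _ _ ih

theorem CrossingChanges.append_left {n : ℕ} {w w' : List Piece} (h : CrossingChanges n w w')
    (u : List Piece) : CrossingChanges n (u ++ w) (u ++ w') := by
  induction u with
  | nil => exact h
  | cons p u ih => exact .keep _ _ _ _ ih

theorem CrossingChanges.eq_of_zero {w w' : List Piece} (h : CrossingChanges 0 w w') : w = w' := by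
  generalize hn : 0 = n at h
  induction h with
  | nil => rfl
  | keep n w w' p h ih => rw [ih hn]
  | change n w w' a b x y s h ih => omega

theorem crossingChanges_plat (n : ℕ) : CrossingChanges 1 (plat n true) (plat n false) := by
  have h : CrossingChanges 1
      (⟨[], .cross true false true, [true, false]⟩ ::
        (List.replicate n (twist false) ++
          [⟨[], .cap false, [true, false]⟩, ⟨[], .cap true, []⟩]))
      (⟨[], .cross true false (!true), [true, false]⟩ ::
        (List.replicate n (twist false) ++
          [⟨[], .cap false, [true, false]⟩, ⟨[], .cap true, []⟩])) :=
    .change 0 _ _ _ _ _ _ _ (.refl _)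
  exact ((CrossingChanges.keep _ _ _ _ h).append_left (List.replicate (n + 1) (twist true))
    ).append_left [⟨[], .cup false, []⟩, ⟨[false, true], .cup true, []⟩]

/-- The plat closure of `σ₂ ^ (n + 1) * σ₂ ^ (-n)`. -/
def trivialPlat (n : ℕ) : List Piece :=
  [⟨[], .cup false, []⟩, ⟨[false, true], .cup true, []⟩] ++ List.replicate (n + 1) (twist true) ++
    (List.replicate n (twist false) ++ [⟨[], .cap false, [true, false]⟩, ⟨[], .cap true, []⟩])

theorem isTangle_trivialPlat (n : ℕ) : IsTangle [] (trivialPlat n) [] := by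
  rw [trivialPlat, List.append_assoc]
  have h := isTangle_append.2 ⟨[false, true, true, false], isTangle_replicate_twist n false,
    show IsTangle _ [⟨[], .cap false, [true, false]⟩, ⟨[], .cap true, []⟩] [] from ⟨rfl, rfl, rfl⟩⟩
  have h' := isTangle_append.2 ⟨_, isTangle_replicate_twist (n + 1) true, h⟩
  exact ⟨rfl, rfl, h'⟩

/-- Two kinks, one created at the maximum and then removed at the minimum, reverse the orientation
of the circle. A snake then creates a second minimum and maximum, a kink is put into the last
maximum, and this crossing is moved below the other maximum and slid across the second minimum to
the middle strands. -/
theorem exists_trivialPlat_zero :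
    ∃ D : KnotDiagram, D.word = trivialPlat 0 ∧ D.knot = unknot := by
  obtain ⟨D₁, w₁, k₁⟩ := KnotDiagram.exists_of_move (D := circle)
    (u := [⟨[], .cup true, []⟩]) (l := [⟨[], .cap true, []⟩])
    (r := [⟨[], .cross true false true, []⟩, ⟨[], .cap false, []⟩]) (v := []) rfl
    (Or.inr (.reidemeister_one_cap [] [] true true)) ⟨rfl, rfl, rfl, rfl⟩ (by simp)
  obtain ⟨D₂, w₂, k₂⟩ := KnotDiagram.exists_of_move (D := D₁)
    (u := []) (l := [⟨[], .cup true, []⟩, ⟨[], .cross true false true, []⟩])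
    (r := [⟨[], .cup false, []⟩]) (v := [⟨[], .cap false, []⟩]) w₁
    (Or.inl (.reidemeister_one_cup [] [] true true)) ⟨rfl, rfl, rfl⟩ (by simp)
  obtain ⟨D₃, w₃, k₃⟩ := KnotDiagram.exists_of_move (D := D₂)
    (u := [⟨[], .cup false, []⟩]) (l := [])
    (r := [⟨[false], .cup true, [true]⟩, ⟨[], .cap false, [false, true]⟩])
    (v := [⟨[], .cap false, []⟩]) w₂
    (Or.inr (.snake_left [] [true] false)) ⟨rfl, rfl, rfl, rfl, rfl⟩ (by simp)
  obtain ⟨D₄, w₄, k₄⟩ := KnotDiagram.exists_of_move (D := D₃)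
    (u := [⟨[], .cup false, []⟩, ⟨[false], .cup true, [true]⟩,
      ⟨[], .cap false, [false, true]⟩])
    (l := [⟨[], .cap false, []⟩])
    (r := [⟨[], .cross false true false, []⟩, ⟨[], .cap true, []⟩]) (v := []) w₃
    (Or.inr (.reidemeister_one_cap [] [] false false)) ⟨rfl, rfl, rfl, rfl, rfl, rfl⟩ (by simp)
  obtain ⟨D₅, w₅, k₅⟩ := KnotDiagram.exists_of_move (D := D₄)
    (u := [⟨[], .cup false, []⟩, ⟨[false], .cup true, [true]⟩])
    (l := [⟨[], .cap false, [false, true]⟩, ⟨[], .cross false true false, []⟩])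
    (r := [⟨[false, true], .cross false true false, []⟩, ⟨[], .cap false, [true, false]⟩])
    (v := [⟨[], .cap true, []⟩]) w₄
    (Or.inl (.interchange [] [] [] (.cap false) (.cross false true false)))
    ⟨rfl, rfl, rfl, rfl, rfl, rfl⟩ (by simp)
  obtain ⟨D₆, w₆, k₆⟩ := KnotDiagram.exists_of_move (D := D₅)
    (u := [⟨[], .cup false, []⟩])
    (l := [⟨[false], .cup true, [true]⟩, ⟨[false, true], .cross false true false, []⟩])
    (r := [⟨[false, true], .cup true, []⟩, ⟨[false], .cross true true true, [false]⟩])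
    (v := [⟨[], .cap false, [true, false]⟩, ⟨[], .cap true, []⟩]) w₅
    (Or.inl (.slide_cup [false] [] true true false))
    ⟨rfl, rfl, rfl, rfl, rfl, rfl⟩ (by simp)
  exact ⟨D₆, w₆, by rw [k₆, k₅, k₄, k₃, k₂, k₁]; rfl⟩

/-- The innermost crossings of σ₂^(n+1) and σ₂^(-n) form a Reidemeister II pair. -/
theorem exists_trivialPlat (n : ℕ) :
    ∃ D : KnotDiagram, D.word = trivialPlat n ∧ D.knot = unknot := by
  induction n with
  | zero => exact exists_trivialPlat_zero
  | succ n ih =>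
    obtain ⟨D, hD, hk⟩ := ih
    have h : trivialPlat (n + 1) = ([⟨[], .cup false, []⟩, ⟨[false, true], .cup true, []⟩] ++
        List.replicate (n + 1) (twist true)) ++ [twist true, twist false] ++
          (List.replicate n (twist false) ++
            [⟨[], .cap false, [true, false]⟩, ⟨[], .cap true, []⟩]) := by
      rw [trivialPlat, List.replicate_succ' (n := n + 1), List.replicate_succ (n := n) (a := twist false)]
      simp
    obtain ⟨D', hD', hk'⟩ := KnotDiagram.exists_of_move (D := D)
      (u := [⟨[], .cup false, []⟩, ⟨[false, true], .cup true, []⟩] ++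
        List.replicate (n + 1) (twist true)) (l := []) (r := [twist true, twist false])
      (v := List.replicate n (twist false) ++
        [⟨[], .cap false, [true, false]⟩, ⟨[], .cap true, []⟩])
      (by rw [hD, trivialPlat, List.append_nil])
      (Or.inr (.reidemeister_two [false] [false] true true true))
      (h ▸ isTangle_trivialPlat (n + 1)) (by simp)
    exact ⟨D', by rw [hD', h], hk'.trans hk⟩

theorem exists_plat_false (n : ℕ) :
    ∃ D : KnotDiagram, D.word = plat n false ∧ D.knot = unknot := by
  obtain ⟨D, hD, hk⟩ := exists_trivialPlat n
  have h : plat n false = ([⟨[], .cup false, []⟩, ⟨[false, true], .cup true, []⟩] ++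
      List.replicate (n + 1) (twist true)) ++ [⟨[], .cross false true true, [true, false]⟩,
        ⟨[], .cross true false false, [true, false]⟩] ++ (List.replicate n (twist false) ++
          [⟨[], .cap false, [true, false]⟩, ⟨[], .cap true, []⟩]) := by
    simp [plat, platTop]
  obtain ⟨D', hD', hk'⟩ := KnotDiagram.exists_of_move (D := D)
    (u := [⟨[], .cup false, []⟩, ⟨[false, true], .cup true, []⟩] ++
      List.replicate (n + 1) (twist true)) (l := [])
    (r := [⟨[], .cross false true true, [true, false]⟩,
      ⟨[], .cross true false false, [true, false]⟩])
    (v := List.replicate n (twist false) ++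
      [⟨[], .cap false, [true, false]⟩, ⟨[], .cap true, []⟩])
    (by rw [hD, trivialPlat, List.append_nil])
    (Or.inr (.reidemeister_two [] [true, false] false true true))
    (h ▸ isTangle_plat n false) (by simp)
  exact ⟨D', by rw [hD', h], hk'.trans hk⟩

/-- Crossing changes preserve the components, so connectedness is inherited from the unknot diagram
`plat n false`. -/
theorem hasConstantColorings_plat (n : ℕ) : HasConstantColorings (plat n true) := by
  obtain ⟨D, hD, -⟩ := exists_plat_false n
  have h := (connected_iff D.isTangle).1 D.connected
  rw [hD] at h
  exact fun e he => h e ((crossingChanges_plat n).col he)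

/-- The two-bridge knot that is the plat closure of `σ₂ ^ (n + 1) * σ₁ ^ 2 * σ₂ ^ (-n)`. -/
def platDiagram (n : ℕ) : KnotDiagram where
  word := plat n true
  isTangle := isTangle_plat n true
  nonempty := nonempty_points (isTangle_plat n true) (by simp [plat])
  connected := (connected_iff (isTangle_plat n true)).2 (hasConstantColorings_plat n)

theorem countP_isCap_plat (n : ℕ) (s : Bool) : (plat n s).countP Piece.isCap = 2 := by
  have h : ∀ (n : ℕ) (s : Bool), (List.replicate n (twist s)).countP Piece.isCap = 0 := by
    intro n s
    rw [List.countP_eq_zero]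
    intro p hp
    rw [List.eq_of_mem_replicate hp]
    simp [twist, Piece.isCap]
  simp [plat, platTop, List.countP_append, h, List.countP_cons, Piece.isCap]

/-! ### The Alexander polynomials: degree, constant term and value at -1. -/

/-- The polynomial `1 - t + t ^ 2 - ⋯` with `n` terms. -/
noncomputable def altSum (n : ℕ) : ℤ[X] := ∑ i ∈ Finset.range n, (-X) ^ i

/-- The Alexander polynomial of `platDiagram n`. -/
noncomputable def platPolynomial (n : ℕ) : ℤ[X] := altSum (n + 1) ^ 2 - X * altSum n ^ 2

theorem altSum_succ (n : ℕ) : altSum (n + 1) = altSum n + (-X) ^ n := by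
  simp [altSum, Finset.sum_range_succ]

theorem altSum_succ' (n : ℕ) : altSum (n + 1) = 1 - X * altSum n := by
  simp only [altSum, Finset.sum_range_succ', pow_succ, Finset.mul_sum]
  rw [pow_zero, add_comm, sub_eq_add_neg, ← Finset.sum_neg_distrib]
  congr 1
  exact Finset.sum_congr rfl fun i _ => by ring

theorem natDegree_altSum_succ (n : ℕ) : (altSum (n + 1)).natDegree = n := by
  induction n with
  | zero => simp [altSum]
  | succ n ih =>
    have h : ((-X : ℤ[X]) ^ (n + 1)).natDegree = n + 1 := by
      rw [natDegree_pow, natDegree_neg, natDegree_X, mul_one]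
    rw [altSum_succ, natDegree_add_eq_right_of_natDegree_lt, h]
    omega

/-- The square has degree 2(n+1) and the subtracted term has degree 2n + 1, so the leading term
survives. -/
theorem natDegree_platPolynomial (n : ℕ) : (platPolynomial (n + 1)).natDegree = 2 * (n + 1) := by
  have h1 : (altSum (n + 2) ^ 2).natDegree = 2 * (n + 1) := by
    rw [natDegree_pow, natDegree_altSum_succ]
  rw [platPolynomial, natDegree_sub_eq_left_of_natDegree_lt, h1]
  rw [h1]
  refine natDegree_mul_le.trans_lt ?_
  rw [natDegree_X, natDegree_pow, natDegree_altSum_succ]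
  omega

theorem coeff_zero_platPolynomial (n : ℕ) : (platPolynomial n).coeff 0 = 1 := by
  rw [platPolynomial, altSum_succ', coeff_zero_eq_eval_zero]
  simp

/-- The homomorphism that maps `t` to `-1`. -/
noncomputable def evalNegOne : ℤ[T;T⁻¹] →+* ℤ := LaurentPolynomial.eval₂ (RingHom.id ℤ) (-1)

/-- At t = -1 every term of `altSum` is 1, and the factor -X becomes 1, which turns the difference
into a sum of squares. -/
theorem evalNegOne_platPolynomial (n : ℕ) :
    evalNegOne (toLaurent (platPolynomial n)) = (n + 1) ^ 2 + n ^ 2 := by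
  simp [evalNegOne, platPolynomial, altSum]

/-! ### The Alexander ideal of the plats. -/

section Col

variable {X : Type*} {Q : ColorRule X}

theorem exists_col_cons {p : Piece} {w : List Piece} {c d : List X} :
    (∃ e, Q.Col (p :: w) c e d) ↔ ∃ c', Q.PieceCol p c c' ∧ ∃ e, Q.Col w c' e d := by
  constructor
  · rintro ⟨_, c', e, rfl, hp, h⟩
    exact ⟨c', hp, e, h⟩
  · rintro ⟨c', hp, e, h⟩
    exact ⟨_, c', e, rfl, hp, h⟩

theorem exists_col_append {v w : List Piece} {c d : List X} :
    (∃ e, Q.Col (v ++ w) c e d) ↔ ∃ c', (∃ e, Q.Col v c e c') ∧ ∃ e, Q.Col w c' e d := by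
  constructor
  · rintro ⟨_, h⟩
    obtain ⟨e₁, e₂, c', rfl, h1, h2⟩ := col_append.1 h
    exact ⟨c', ⟨e₁, h1⟩, e₂, h2⟩
  · rintro ⟨c', ⟨e₁, h1⟩, e₂, h2⟩
    exact ⟨_, col_append.2 ⟨e₁, e₂, c', rfl, h1, h2⟩⟩

theorem exists_col_nil {c d : List X} : (∃ e, Q.Col [] c e d) ↔ c = d :=
  ⟨fun ⟨_, h⟩ => h.2, fun h => ⟨[], rfl, h⟩⟩

theorem pieceCol_cross_middle {x y s u v : Bool} {z p q z' : X} {c : List X} :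
    Q.PieceCol ⟨[u], .cross x y s, [v]⟩ [z, p, q, z'] c ↔
      c = [z, Q.topLeft x s p q, Q.topRight y s p q, z'] := by
  constructor
  · rintro ⟨A, B, _, _, hA, hB, ⟨p', q', rfl, rfl⟩, h, rfl⟩
    obtain ⟨a, rfl⟩ := List.length_eq_one_iff.1 hA
    obtain ⟨b, rfl⟩ := List.length_eq_one_iff.1 hB
    simp only [List.cons_append, List.nil_append, List.cons.injEq] at h
    obtain ⟨rfl, rfl, rfl, rfl, -⟩ := h
    rfl
  · rintro rfl
    exact ⟨[z], [z'], _, _, rfl, rfl, ⟨p, q, rfl, rfl⟩, rfl, rfl⟩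

theorem pieceCol_cross_left {x y s u v : Bool} {z p q z' : X} {c : List X} :
    Q.PieceCol ⟨[], .cross x y s, [u, v]⟩ [p, q, z, z'] c ↔
      c = [Q.topLeft x s p q, Q.topRight y s p q, z, z'] := by
  constructor
  · rintro ⟨A, B, _, _, hA, hB, ⟨p', q', rfl, rfl⟩, h, rfl⟩
    obtain rfl := List.length_eq_zero_iff.1 hA
    simp only [List.cons_append, List.nil_append, List.cons.injEq] at h
    obtain ⟨rfl, rfl, rfl⟩ := h
    rfl
  · rintro rfl
    exact ⟨[], [z, z'], _, _, rfl, rfl, ⟨p, q, rfl, rfl⟩, rfl, rfl⟩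

theorem pieceCol_cap_left {o : Bool} {b : List Bool} {p q : X} {B c : List X}
    (hb : B.length = b.length) :
    Q.PieceCol ⟨[], .cap o, b⟩ (p :: q :: B) c ↔ p = q ∧ c = B := by
  constructor
  · rintro ⟨A, B, _, _, hA, hB, ⟨⟨z, rfl⟩, rfl⟩, h, rfl⟩
    obtain rfl := List.length_eq_zero_iff.1 hA
    simp only [List.cons_append, List.nil_append, List.cons.injEq] at h
    obtain ⟨rfl, rfl, rfl⟩ := h
    exact ⟨rfl, rfl⟩
  · rintro ⟨rfl, rfl⟩
    exact ⟨[], c, _, _, rfl, hb, ⟨⟨p, rfl⟩, rfl⟩, rfl, rfl⟩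

end Col

section Module

variable {N : Type*} [AddCommGroup N] [Module ℤ[T;T⁻¹] N]

theorem alexanderRule_act_add_smul (s : Bool) (a v : N) (f g : ℤ[T;T⁻¹]) :
    (alexanderRule N).act s (a + f • v) (a + g • v) =
      a + (T (bif s then 1 else -1) * (f - g) + g) • v := by
  simp only [alexanderRule]
  module

/-- Each crossing multiplies the difference of the two middle colours by -t and adds t times the old
difference to the left one. The left colour thus accumulates a geometric sum, t times `altSum k`. -/
theorem exists_col_twist_true (k : ℕ) (z z' a v : N) (f g : ℤ[T;T⁻¹]) (d : List N) :
    (∃ e, (alexanderRule N).Col (List.replicate k (twist true))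
        [z, a + f • v, a + g • v, z'] e d) ↔
      [z, a + (f + T 1 * toLaurent (altSum k) * (g - f)) • v,
        a + (f + (T 1 * toLaurent (altSum k) + (-T 1) ^ k) * (g - f)) • v, z'] = d := by
  induction k generalizing f g with
  | zero => simp [exists_col_nil, altSum]
  | succ k ih =>
    rw [List.replicate_succ, exists_col_cons]
    simp only [twist, pieceCol_cross_middle, exists_eq_left] at ih ⊢
    simp only [topLeft, topRight, cond_true, alexanderRule_act_add_smul]
    rw [ih, altSum_succ']
    simp only [map_sub, map_mul, map_one, toLaurent_X]
    ring_nf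

/-- The inverse crossing multiplies the difference by -t⁻¹, and the left colour moves by the old
difference. The geometric sum in -t⁻¹ is rewritten as -t (-t⁻¹)^k times `altSum k`, so that both
twist regions involve the same polynomials. -/
theorem exists_col_twist_false (k : ℕ) (z z' a v : N) (f g : ℤ[T;T⁻¹]) (d : List N) :
    (∃ e, (alexanderRule N).Col (List.replicate k (twist false))
        [z, a + f • v, a + g • v, z'] e d) ↔
      [z, a + (f - T 1 * (-T (-1)) ^ k * toLaurent (altSum k) * (g - f)) • v,
        a + (f - T 1 * (-T (-1)) ^ k * toLaurent (altSum k) * (g - f) +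
          (-T (-1)) ^ k * (g - f)) • v, z'] = d := by
  induction k generalizing f g with
  | zero => simp [exists_col_nil, altSum]
  | succ k ih =>
    have hT : (T 1 * T (-1) : ℤ[T;T⁻¹]) = 1 := by rw [← T_add]; simp
    have hw : ((-T 1) ^ k * (-T (-1)) ^ k : ℤ[T;T⁻¹]) = 1 := by
      rw [← mul_pow, neg_mul_neg, hT, one_pow]
    have h1 : toLaurent (altSum (k + 1)) = toLaurent (altSum k) + (-T 1) ^ k := by
      rw [altSum_succ]; simp
    rw [List.replicate_succ, exists_col_cons]
    simp only [twist, pieceCol_cross_middle, exists_eq_left] at ih ⊢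
    simp only [topLeft, topRight, cond_false, Bool.not_true, alexanderRule_act_add_smul]
    rw [ih, h1]
    have e1 : g - T 1 * (-T (-1)) ^ k * toLaurent (altSum k) * (T (-1) * (f - g) + g - g) =
        f - T 1 * (-T (-1)) ^ (k + 1) * (toLaurent (altSum k) + (-T 1) ^ k) * (g - f) := by
      linear_combination (g - f) * (-1 : ℤ[T;T⁻¹]) * hw * T 1 * T (-1) - (g - f) * hT
    have e2 : (-T (-1)) ^ k * (T (-1) * (f - g) + g - g) = (-T (-1)) ^ (k + 1) * (g - f) := by
      ring
    rw [e1, e2]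

/-- The colourings of `platTop n true`. -/
theorem exists_col_platTop (n : ℕ) (a v : N) :
    (∃ e, (alexanderRule N).Col (platTop n true) [a, a, a + v, a + v] e []) ↔
      toLaurent (platPolynomial n) • v = 0 := by
  have hT : (T 1 * T (-1) : ℤ[T;T⁻¹]) = 1 := by rw [← T_add]; simp
  have hw : ((-T 1) ^ n * (-T (-1)) ^ n : ℤ[T;T⁻¹]) = 1 := by
    rw [← mul_pow, neg_mul_neg, hT, one_pow]
  have h1 : toLaurent (altSum (n + 1)) = toLaurent (altSum n) + (-T 1) ^ n := by
    rw [altSum_succ]; simp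
  have h2 : toLaurent (altSum (n + 1)) = 1 - T 1 * toLaurent (altSum n) := by
    rw [altSum_succ']; simp
  have h0 : ([a, a, a + v, a + v] : List N) = [a + (0 : ℤ[T;T⁻¹]) • v, a + (0 : ℤ[T;T⁻¹]) • v,
      a + (1 : ℤ[T;T⁻¹]) • v, a + (1 : ℤ[T;T⁻¹]) • v] := by simp
  rw [h0, platTop]
  simp only [exists_col_append, exists_col_cons, exists_col_nil, exists_col_twist_true,
    pieceCol_cross_left, exists_eq_left, exists_eq_left', topLeft, topRight, cond_true,
    alexanderRule_act_add_smul, exists_col_twist_false, cond_false]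
  simp only [pieceCol_cap_left, List.length_cons, List.length_nil, and_assoc, exists_and_left,
    exists_eq_left, and_true, add_right_inj]
  -- The two maxima force the first two colours to agree and the third to equal the last, which is
  -- still a + v. Each condition says that a coefficient annihilates v.
  rw [← sub_eq_zero, ← sub_smul, ← sub_eq_zero (b := (1 : ℤ[T;T⁻¹]) • v), ← sub_smul]
  have hΔ : toLaurent (platPolynomial n) =
      toLaurent (altSum (n + 1)) ^ 2 - T 1 * toLaurent (altSum n) ^ 2 := by
    simp [platPolynomial]
  generalize toLaurent (altSum (n + 1)) = g' at *
  generalize toLaurent (altSum n) = g at *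
  generalize toLaurent (platPolynomial n) = Δ at *
  rw [pow_succ]
  generalize (-T 1 : ℤ[T;T⁻¹]) ^ n = w at *
  generalize (-T (-1) : ℤ[T;T⁻¹]) ^ n = w' at *
  generalize (T 1 : ℤ[T;T⁻¹]) = t at *
  generalize (T (-1) : ℤ[T;T⁻¹]) = t' at *
  subst hΔ
  -- This is the top left coefficient after the first σ₁ crossing, where the factor t⁻¹ cancels the
  -- t from the twists.
  have hc : t' * (0 + t * g' * (1 - 0) - 0) + 0 = g' := by linear_combination g' * hT
  rw [hc]
  subst h1
  -- Both coefficients are unit multiples of Δ, with units -t w' and -w', so the two conditions are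
  -- equivalent and either one suffices.
  have e1 : t * (0 - (g + w)) + (g + w) - (g + w - t * w' * g *
      (0 + (t * (g + w) + w * -t) * (1 - 0) - (g + w))) = -(t * w') * ((g + w) ^ 2 - t * g ^ 2) := by
    linear_combination (t * (g + w)) * hw
  have e2 : g + w - t * w' * g * (0 + (t * (g + w) + w * -t) * (1 - 0) - (g + w)) +
      w' * (0 + (t * (g + w) + w * -t) * (1 - 0) - (g + w)) - 1 =
        -w' * ((g + w) ^ 2 - t * g ^ 2) := by
    linear_combination (1 - w' * (t * g - (g + w))) * h2 + t * g * hw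
  rw [e1, e2, mul_smul, mul_smul]
  constructor
  · rintro ⟨-, h⟩
    have := congrArg (fun y => (-w) • y) h
    simpa only [smul_zero, smul_smul, neg_mul_neg, ← mul_assoc, hw, one_mul] using this
  · intro h
    rw [h]
    simp

end Module

theorem col_plat {X : Type*} {Q : ColorRule X} {n : ℕ} {s : Bool} {e : List (List X)} :
    Q.Col (plat n s) [] e [] ↔ ∃ a b e', e = [a, a] :: [a, a, b, b] :: e' ∧
      Q.Col (platTop n s) [a, a, b, b] e' [] := by
  constructor
  · rintro ⟨_, _, rfl, ⟨A, B, _, _, hA, hB, ⟨rfl, a, rfl⟩, h, rfl⟩,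
      _, e', rfl, ⟨A', B', _, _, hA', hB', ⟨rfl, b, rfl⟩, h', rfl⟩, he⟩
    obtain rfl := List.length_eq_zero_iff.1 hA
    obtain rfl := List.length_eq_zero_iff.1 hB
    obtain rfl := List.length_eq_zero_iff.1 hB'
    simp only [List.append_nil, List.nil_append] at h'
    subst h'
    exact ⟨a, b, e', by simp, by simpa using he⟩
  · rintro ⟨a, b, e', rfl, he⟩
    exact ⟨_, _, rfl, ⟨[], [], _, _, rfl, rfl, ⟨rfl, a, rfl⟩, rfl, rfl⟩,
      _, _, rfl, ⟨[a, a], [], _, _, rfl, rfl, ⟨rfl, b, rfl⟩, rfl, rfl⟩, he⟩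

theorem isCup_of_mem_platTop {n : ℕ} {s : Bool} {p : Piece} (hp : p ∈ platTop n s) :
    p.isCup = false := by
  simp only [platTop, List.mem_append, List.mem_cons, List.not_mem_nil, or_false] at hp
  rcases hp with hp | (rfl | rfl) | hp | rfl | rfl
  · rw [List.eq_of_mem_replicate hp]; rfl
  · rfl
  · rfl
  · rw [List.eq_of_mem_replicate hp]; rfl
  · rfl
  · rfl

theorem smul_one_quotient_eq_zero_iff {R : Type*} [CommRing R] (I : Ideal R) (r : R) :
    r • (1 : R ⧸ I) = 0 ↔ r ∈ I := by
  have h : r • (1 : R ⧸ I) = Ideal.Quotient.mk I (r * 1) := rfl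
  rw [h, mul_one, Ideal.Quotient.eq_zero_iff_mem]

/-- The module is generated by the colours a, b of the two minima, as the rest of the diagram has no
minimum. The row (-Δ, Δ) gives one inclusion. For the other, a test colouring in Λ ⊕ Λ/(Δ), where Λ
is the ring of Laurent polynomials, shows that every relation among a and b has both coefficients in
(Δ). -/
theorem alexanderIdeal_plat (n : ℕ) :
    alexanderIdeal (plat n true) = Ideal.span {toLaurent (platPolynomial n)} := by
  have hne := (platDiagram n).nonempty
  obtain ⟨M, _, _, e, m, y, he, -, -⟩ := exists_isUniversal (isTangle_plat n true) hne
  obtain ⟨a, b, e', rfl, hcol⟩ := col_plat.1 he.col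
  have hrel : toLaurent (platPolynomial n) • (b - a) = 0 := by
    rw [← exists_col_platTop n a (b - a), add_sub_cancel]
    exact ⟨e', hcol⟩
  have hspan : Submodule.span ℤ[T;T⁻¹] (Set.range ![a, b]) = ⊤ := by
    rw [eq_top_iff, ← he.span]
    refine Submodule.span_le.2 ?_
    have ha : a ∈ Submodule.span ℤ[T;T⁻¹] (Set.range ![a, b]) := Submodule.subset_span ⟨0, rfl⟩
    have hb : b ∈ Submodule.span ℤ[T;T⁻¹] (Set.range ![a, b]) := Submodule.subset_span ⟨1, rfl⟩
    have hab : ∀ x ∈ [a, a, b, b], x ∈ Submodule.span ℤ[T;T⁻¹] (Set.range ![a, b]) := by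
      intro x hx
      have : x = a ∨ x = b := by simpa using hx
      rcases this with rfl | rfl
      · exact ha
      · exact hb
    obtain ⟨t, ht, h⟩ := exists_finset_span (Submodule.span ℤ[T;T⁻¹] (Set.range ![a, b])) hcol hab
    have ht0 : t = ∅ := by
      rw [List.countP_eq_zero.2 fun p hp => by simp [isCup_of_mem_platTop hp]] at ht
      simpa using ht
    rintro x ⟨l, hl, hx⟩
    rw [List.mem_cons, List.mem_cons] at hl
    rcases hl with rfl | rfl | hl
    · obtain rfl : x = a := by simpa using hx
      exact ha
    · exact hab x hx
    · simpa [ht0] using h l hl x hx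
  rw [he.alexanderIdeal_eq (isTangle_plat n true) hne ![a, b] hspan]
  refine le_antisymm (Ideal.span_le.2 ?_) ((Ideal.span_singleton_le_iff_mem _).2 ?_)
  · rintro _ ⟨k, r, c, hk, hr, rfl⟩
    obtain rfl : k = 1 := by simpa using hk.symm
    let I : Ideal ℤ[T;T⁻¹] := Ideal.span {toLaurent (platPolynomial n)}
    -- In the test colouring a = (1, 0) and b = (1, 1). The first component of a relation says that
    -- its coefficients sum to 0, the second that the coefficient of b lies in (Δ).
    let v : ℤ[T;T⁻¹] × (ℤ[T;T⁻¹] ⧸ I) := (0, 1)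
    have hv : toLaurent (platPolynomial n) • v = 0 := by
      refine Prod.ext (by simp [v]) ?_
      simp only [v, Prod.smul_mk, Prod.snd_zero]
      exact (smul_one_quotient_eq_zero_iff I _).2 (Ideal.mem_span_singleton_self _)
    obtain ⟨f, hf⟩ := (exists_col_platTop n (1, 0) v).2 hv
    obtain ⟨φ, hφ⟩ := he.lift _ _ (col_plat.2 ⟨_, _, f, rfl, hf⟩)
    simp only [List.map_cons, List.map_nil, List.cons.injEq, and_true] at hφ
    obtain ⟨⟨ha, -⟩, ⟨-, -, hb, -⟩, -⟩ := hφ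
    have h0 := congrArg φ (hr 0)
    rw [Fin.sum_univ_two] at h0
    simp only [Matrix.cons_val_zero, Matrix.cons_val_one, map_add, map_smul, ha, hb, map_zero] at h0
    have h1 : r 0 0 + r 0 1 = 0 := by simpa [v] using congrArg Prod.fst h0
    have h2 : r 0 1 ∈ I := by
      have := congrArg Prod.snd h0
      simp only [v, Prod.snd_add, Prod.smul_snd, smul_zero, zero_add, Prod.snd_zero] at this
      exact (smul_one_quotient_eq_zero_iff I _).1 this
    have h3 : r 0 0 ∈ I := by
      rw [eq_neg_of_add_eq_zero_left h1]
      exact I.neg_mem h2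
    rw [Matrix.det_fin_one]
    have : ∀ i, r 0 i ∈ I := Fin.forall_fin_two.2 ⟨h3, h2⟩
    exact this _
  · refine Ideal.subset_span ⟨1, fun _ => ![-toLaurent (platPolynomial n),
      toLaurent (platPolynomial n)], fun _ => 1, by simp, fun _ => ?_, by simp⟩
    rw [Fin.sum_univ_two]
    simp only [Matrix.cons_val_zero, Matrix.cons_val_one]
    rw [neg_smul, neg_add_eq_sub, ← smul_sub, hrel]

/-! ### Distinctness, bridge number and unknotting number. -/

theorem alexanderIdeal_of_knot_eq_plat {D : KnotDiagram} {n : ℕ}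
    (h : D.knot = (platDiagram n).knot) :
    alexanderIdeal D.word = Ideal.span {toLaurent (platPolynomial n)} :=
  (alexanderIdeal_eq_of_knot_eq h).trans (alexanderIdeal_plat n)

/-- A unit would have the value 1 or -1 at t = -1, but for n ≥ 1 the value is (n+1)² + n² ≥ 5. -/
theorem platPolynomial_ideal_ne_top {n : ℕ} (hn : n ≠ 0) :
    Ideal.span {toLaurent (platPolynomial n)} ≠ ⊤ := by
  intro h
  have h1 := (Ideal.span_singleton_eq_top.1 h).map evalNegOne
  rw [evalNegOne_platPolynomial, Int.isUnit_iff] at h1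
  have : 1 ≤ n := Nat.one_le_iff_ne_zero.2 hn
  zify at this
  rcases h1 with h1 | h1 <;> nlinarith

/-- Generators of equal ideals are associated, so their values at -1 agree up to sign; these values
are positive and strictly increasing in n. -/
theorem knot_platDiagram_injective : Function.Injective fun n => (platDiagram n).knot := by
  intro m n h
  have h1 := (alexanderIdeal_of_knot_eq_plat (D := platDiagram m) rfl).symm.trans
    (alexanderIdeal_of_knot_eq_plat h)
  have h2 := (Ideal.span_singleton_eq_span_singleton.1 h1).map evalNegOne
  rw [evalNegOne_platPolynomial, evalNegOne_platPolynomial, Int.associated_iff] at h2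
  zify
  rcases h2 with h2 | h2
  · have h3 : ((m : ℤ) - n) * (m + n + 1) = 0 := by linarith
    rcases mul_eq_zero.1 h3 with h3 | h3 <;> omega
  · nlinarith

theorem two_le_countP_isCap {D : KnotDiagram} {n : ℕ} (hn : n ≠ 0)
    (h : D.knot = (platDiagram n).knot) : 2 ≤ D.word.countP Piece.isCap := by
  by_contra! hlt
  refine platPolynomial_ideal_ne_top hn ?_
  rw [← alexanderIdeal_of_knot_eq_plat h]
  exact alexanderIdeal_eq_top D (by omega)

theorem isTwoBridge_plat {n : ℕ} (hn : n ≠ 0) : IsTwoBridge (platDiagram n).knot := by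
  have h : 2 ∈ {k | ∃ D : KnotDiagram, D.knot = (platDiagram n).knot ∧
      D.word.countP Piece.isCap = k} := ⟨platDiagram n, rfl, countP_isCap_plat n true⟩
  refine le_antisymm (Nat.sInf_le h) (le_csInf ⟨2, h⟩ ?_)
  rintro _ ⟨D, hD, rfl⟩
  exact two_le_countP_isCap hn hD

theorem unknottingNumber_plat {n : ℕ} (hn : n ≠ 0) :
    unknottingNumber (platDiagram n).knot = 1 := by
  obtain ⟨D', hD', hk⟩ := exists_plat_false n
  have h : 1 ∈ {k | ∃ D D' : KnotDiagram, D.knot = (platDiagram n).knot ∧ D'.knot = unknot ∧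
      CrossingChanges k D.word D'.word} :=
    ⟨platDiagram n, D', rfl, hk, by rw [hD']; exact crossingChanges_plat n⟩
  refine le_antisymm (Nat.sInf_le h) (le_csInf ⟨1, h⟩ ?_)
  rintro k ⟨D, D', hD, hD', hc⟩
  by_contra! hlt
  -- With no crossing changed, one word would represent both the plat knot and the unknot, whose
  -- ideal is the unit ideal because the circle has one maximum.
  obtain rfl : k = 0 := by omega
  have hw := hc.eq_of_zero
  refine platPolynomial_ideal_ne_top hn ?_
  rw [← alexanderIdeal_of_knot_eq_plat hD, hw, alexanderIdeal_eq_of_knot_eq (D' := circle) hD']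
  exact alexanderIdeal_eq_top circle (by simp [circle, Piece.isCap])

theorem isAlexanderPolynomial_plat (n : ℕ) :
    IsAlexanderPolynomial (platDiagram n).knot (platPolynomial n) :=
  ⟨by simp [coeff_zero_platPolynomial], fun _ h => alexanderIdeal_of_knot_eq_plat h⟩

end KnotTheory

theorem mainTheorem2 :
    ∃ (K : ℕ → KnotTheory.Knot) (Δ : ℕ → Polynomial ℤ),
      Function.Injective K ∧
      (∀ i, KnotTheory.IsTwoBridge (K i) ∧ KnotTheory.unknottingNumber (K i) = 1 ∧
        KnotTheory.IsAlexanderPolynomial (K i) (Δ i)) ∧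
      Filter.Tendsto (fun i => (Δ i).natDegree) Filter.atTop Filter.atTop := by
  -- The index is shifted because `platPolynomial 0` is 1, which gives no lower bounds.
  refine ⟨fun i => (KnotTheory.platDiagram (i + 1)).knot,
    fun i => KnotTheory.platPolynomial (i + 1),
    fun i j h => Nat.succ.inj (KnotTheory.knot_platDiagram_injective h),
    fun i => ⟨KnotTheory.isTwoBridge_plat i.succ_ne_zero,
      KnotTheory.unknottingNumber_plat i.succ_ne_zero,
      KnotTheory.isAlexanderPolynomial_plat _⟩, ?_⟩
  refine Filter.tendsto_atTop_mono (fun i => ?_) Filter.tendsto_id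
  rw [KnotTheory.natDegree_platPolynomial]
  simp only [id]
  omega
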